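/- Let $K$ be a field of characteristic zero equipped with a non-trivial valuation, i.e. a non-trivial real-valued absolute value $|\cdot|$ (archimedean or not; $K$ need not be complete). For a finite tuple of variables $z=(z_1,\dots,z_k)$ let $K\{z\}\subset K[[z]]$ be the subring of convergent power series, i.e. of those $\sum_{\alpha}a_\alpha z^\alpha$ for which $\sum_\alpha |a_\alpha|\,r^{|\alpha|}<\infty$ for some real $r>0$. Let $m,n,N\ge 0$ be integers, $x=(x_1,\dots,x_n)$, $y=(y_1,\dots,y_N)$, and let $f(x,y)=(f_1(x,y),\dots,f_m(x,y))\in K\{x,y\}^m$. Suppose that $\bar y(x)=(\bar y_1(x),\dots,\bar y_N(x))\in K[[x]]^N$ is a sequence of formal power series without constant term such that $f(x,\bar y(x))=0$ in $K[[x]]^m$. Then there exist an integer $s\ge 0$, new variables $t=(t_1,\dots,t_s)$, a sequence of convergent power series $y(x,t)=(y_1(x,t),\dots,y_N(x,t))\in K\{x,t\}^N$ with $y(0,0)=0$, and a sequence of formal power series $\bar t(x)=(\bar t_1(x),\dots,\bar t_s(x))\in K[[x]]^s$ with $\bar t(0)=0$, such that $$f(x,y(x,t))=0 \text{ in } K[[x,t]]^m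 \qquad\text{and}\qquad \bar y(x)=y(x,\bar t(x)).$$ -/

import Mathlib

/-- A formal power series `f` in the variables indexed by `σ`, with coefficients in a field `K`
carrying the absolute value `v`, is convergent if for some radius `r > 0` the series of real
numbers `∑ |a_d| r ^ |d|` converges, where `a_d` is the coefficient of the monomial with exponent
`d` and `|d|` is its total degree. -/
def MvPowerSeries.IsConvergent {K : Type*} [Field K] (v : AbsoluteValue K ℝ) {σ : Type*}
    (f : MvPowerSeries σ K) : Prop :=
  ∃ r : ℝ, 0 < r ∧ Summable fun d : σ →₀ ℕ => v (MvPowerSeries.coeff d f) * r ^ d.degree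

/-! The proof establishes a stronger statement by induction on the number of base variables: for
every formal `ybar` without constant term there is one convergent family through `ybar` on which all
convergent relations of `ybar` vanish. The strength matters, because the inductive hypothesis is
applied to relations that only appear during the proof.

Choose convergent relations `f` of `ybar`, as many as possible, with a Jacobian minor `δ` that does
not vanish along `ybar`. By maximality, `δ` times the derivatives of any relation is a combination
of the derivatives of `f`, up to further relations. In characteristic zero this forces every
relation to vanish on any convergent family through `ybar` on which `f` vanishes
(`relations_vanish_of_jacobian`). So only the system `f = 0` must be solved.

After a linear change of `x`, the series `δ(x, ybar)` is regular in one variable, hence a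
Weierstrass polynomial `W` times a unit. Dividing `ybar` by `W ^ 2` leaves polynomials in that
variable whose coefficients, like those of `W`, are formal series in fewer variables. Treat these
coefficients as unknowns and divide `f` and `δ` at the generic remainders by the square of the
generic polynomial and by the polynomial itself. The coefficients of the remainders are convergent,
and by uniqueness of division they vanish at the true coefficients. The inductive hypothesis
supplies a convergent family on which they vanish, which gives `Y` with `f(x, Y) = A ^ 2 * G` and
`δ(x, Y) = A * e`, `e` a unit (`hasConvergentFamily_of_regular`). Extra parameters absorb the
difference between `Y` and `ybar`, a multiple of `A ^ 2` along the formal solution. Tougeron's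
substitution `Y + A * M * z`, Taylor's formula, division by `A ^ 2` and the implicit function
theorem then produce true solutions. Uniqueness of implicit solutions gives `z = 0` along the formal
solution, so the family still passes through `ybar` (`hasConvergentFamily_of_sq_dvd`).

As `K` need not be complete, fixed points are constructed among formal series, which are complete
for the weight filtrations. Convergence follows because a ball of a weighted `ℓ¹`-norm is closed
under coefficientwise limits. -/

open scoped ENNReal

/-! ### Weighted `ℓ¹`-norms of power series. -/

namespace MvPowerSeries

variable {K : Type*} [Field K] {σ τ : Type}

/-- The weight `∏ r_i ^ d_i` of the monomial with exponent `d` for the polyradius `r`. -/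
noncomputable def radiusPow (r : σ → ℝ≥0∞) (d : σ →₀ ℕ) : ℝ≥0∞ := d.prod fun i k => r i ^ k

lemma radiusPow_zero (r : σ → ℝ≥0∞) : radiusPow r 0 = 1 := by simp [radiusPow]

lemma radiusPow_add (r : σ → ℝ≥0∞) (d e : σ →₀ ℕ) :
    radiusPow r (d + e) = radiusPow r d * radiusPow r e := by
  classical
  exact Finsupp.prod_add_index' (by simp) (fun _ _ _ => pow_add _ _ _)

lemma radiusPow_single (r : σ → ℝ≥0∞) (i : σ) (k : ℕ) :
    radiusPow r (Finsupp.single i k) = r i ^ k := by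
  simp [radiusPow]

lemma radiusPow_mono {r s : σ → ℝ≥0∞} (h : ∀ i, r i ≤ s i) (d : σ →₀ ℕ) :
    radiusPow r d ≤ radiusPow s d :=
  Finset.prod_le_prod' fun i _ => pow_le_pow_left' (h i) _

lemma radiusPow_scale (r : σ → ℝ≥0∞) (c : ℝ≥0∞) (w : σ → ℕ) (d : σ →₀ ℕ) :
    radiusPow (fun i => c ^ w i * r i) d = c ^ Finsupp.weight w d * radiusPow r d := by
  simp only [radiusPow, Finsupp.prod, mul_pow, Finset.prod_mul_distrib, Finsupp.weight_apply,
    Finsupp.sum, ← pow_mul, Finset.prod_pow_eq_pow_sum, smul_eq_mul]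
  congr 3
  exact funext fun i => Nat.mul_comm _ _

/-- The absolute value as an extended nonnegative real. -/
noncomputable def eabs (v : AbsoluteValue K ℝ) (a : K) : ℝ≥0∞ := ENNReal.ofReal (v a)

variable (v : AbsoluteValue K ℝ)

@[simp] lemma eabs_zero : eabs v 0 = 0 := by simp [eabs]
@[simp] lemma eabs_one : eabs v 1 = 1 := by simp [eabs]
lemma eabs_mul (a b : K) : eabs v (a * b) = eabs v a * eabs v b := by
  simp [eabs, ENNReal.ofReal_mul]
lemma eabs_add_le (a b : K) : eabs v (a + b) ≤ eabs v a + eabs v b := by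
  rw [eabs, eabs, eabs, ← ENNReal.ofReal_add (v.nonneg _) (v.nonneg _)]
  exact ENNReal.ofReal_le_ofReal (v.add_le a b)
lemma eabs_lt_top (a : K) : eabs v a < ∞ := ENNReal.ofReal_lt_top
lemma eabs_sum_le {ι : Type*} (s : Finset ι) (f : ι → K) :
    eabs v (∑ i ∈ s, f i) ≤ ∑ i ∈ s, eabs v (f i) :=
  Finset.le_sum_of_subadditive _ (eabs_zero v).le (eabs_add_le v) s f

/-- The weighted `ℓ¹`-norm of a power series at the polyradius `r`. -/
noncomputable def l1norm (r : σ → ℝ≥0∞) (f : MvPowerSeries σ K) : ℝ≥0∞ :=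
  ∑' d : σ →₀ ℕ, eabs v (coeff d f) * radiusPow r d

variable {v}

lemma l1norm_mono {r s : σ → ℝ≥0∞} (h : ∀ i, r i ≤ s i) (f : MvPowerSeries σ K) :
    l1norm v r f ≤ l1norm v s f :=
  ENNReal.tsum_le_tsum fun d => mul_le_mul_right (radiusPow_mono h d) _

lemma l1norm_add_le (r : σ → ℝ≥0∞) (f g : MvPowerSeries σ K) :
    l1norm v r (f + g) ≤ l1norm v r f + l1norm v r g := by
  rw [l1norm, l1norm, l1norm, ← ENNReal.tsum_add]
  refine ENNReal.tsum_le_tsum fun d => ?_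
  rw [← add_mul, map_add]
  exact mul_le_mul_left (eabs_add_le v _ _) _

lemma l1norm_monomial (r : σ → ℝ≥0∞) (d : σ →₀ ℕ) (a : K) :
    l1norm v r (monomial d a) = eabs v a * radiusPow r d := by
  classical
  rw [l1norm, tsum_eq_single d]
  · rw [coeff_monomial_same]
  · intro e he
    rw [coeff_monomial_ne he, eabs_zero, zero_mul]

lemma l1norm_C (r : σ → ℝ≥0∞) (a : K) : l1norm v r (C a : MvPowerSeries σ K) = eabs v a := by
  rw [← monomial_zero_eq_C_apply, l1norm_monomial, radiusPow_zero, mul_one]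

lemma l1norm_zero (r : σ → ℝ≥0∞) : l1norm v r (0 : MvPowerSeries σ K) = 0 := by
  simp [l1norm]

lemma l1norm_one (r : σ → ℝ≥0∞) : l1norm v r (1 : MvPowerSeries σ K) = 1 := by
  rw [← map_one C, l1norm_C, eabs_one]

lemma l1norm_X (r : σ → ℝ≥0∞) (i : σ) : l1norm v r (X i : MvPowerSeries σ K) = r i := by
  rw [X, l1norm_monomial, radiusPow_single, eabs_one, one_mul, pow_one]

lemma l1norm_mul_le (r : σ → ℝ≥0∞) (f g : MvPowerSeries σ K) :
    l1norm v r (f * g) ≤ l1norm v r f * l1norm v r g := by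
  classical
  have h : l1norm v r f * l1norm v r g = ∑' p : (σ →₀ ℕ) × (σ →₀ ℕ),
      (eabs v (coeff p.1 f) * radiusPow r p.1) * (eabs v (coeff p.2 g) * radiusPow r p.2) := by
    rw [ENNReal.tsum_prod', l1norm, l1norm, ← ENNReal.tsum_mul_right]
    exact tsum_congr fun d => ENNReal.tsum_mul_left.symm
  rw [h, ← Finset.HasAntidiagonal.sigmaAntidiagonalEquivProd.tsum_eq, ENNReal.tsum_sigma']
  refine ENNReal.tsum_le_tsum fun d => ?_
  rw [tsum_fintype, coeff_mul]
  refine (mul_le_mul_left (eabs_sum_le v _ _) _).trans ?_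
  rw [Finset.sum_mul, ← Finset.sum_coe_sort]
  refine Finset.sum_le_sum fun p _ => le_of_eq ?_
  have hp : (p : (σ →₀ ℕ) × (σ →₀ ℕ)).1 + (p : (σ →₀ ℕ) × (σ →₀ ℕ)).2 = d :=
    Finset.HasAntidiagonal.mem_antidiagonal.mp p.2
  simp only [Finset.HasAntidiagonal.sigmaAntidiagonalEquivProd_apply]
  have hr : radiusPow r d = radiusPow r (p : (σ →₀ ℕ) × (σ →₀ ℕ)).1 *
      radiusPow r (p : (σ →₀ ℕ) × (σ →₀ ℕ)).2 := by rw [← radiusPow_add, hp]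
  rw [eabs_mul, hr]
  ring

lemma l1norm_pow_le (r : σ → ℝ≥0∞) (f : MvPowerSeries σ K) (n : ℕ) :
    l1norm v r (f ^ n) ≤ l1norm v r f ^ n := by
  induction n with
  | zero => simp [l1norm_one]
  | succ n ih =>
    rw [pow_succ, pow_succ]
    exact (l1norm_mul_le r _ _).trans (mul_le_mul_left ih _)

lemma l1norm_prod_le {ι : Type*} (r : σ → ℝ≥0∞) (s : Finset ι) (f : ι → MvPowerSeries σ K) :
    l1norm v r (∏ i ∈ s, f i) ≤ ∏ i ∈ s, l1norm v r (f i) :=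
  Finset.le_prod_of_submultiplicative _ (l1norm_one r).le (l1norm_mul_le r) s f

/-- Sums may be interchanged freely in `ℝ≥0∞`, so submultiplicativity of the norm suffices and no
convergence has to be assumed. -/
lemma l1norm_subst_le (r : τ → ℝ≥0∞) {a : σ → MvPowerSeries τ K} (ha : HasSubst a)
    (f : MvPowerSeries σ K) :
    l1norm v r (subst a f) ≤ l1norm v (fun i => l1norm v r (a i)) f := by
  have h1 : ∀ e, eabs v (coeff e (subst a f)) ≤ ∑' d, eabs v (coeff d f) *
      eabs v (coeff e (d.prod fun s k => a s ^ k)) := by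
    intro e
    rw [coeff_subst ha, finsum_eq_sum _ (coeff_subst_finite ha f e)]
    refine (eabs_sum_le v _ _).trans ?_
    simp only [smul_eq_mul, eabs_mul]
    exact ENNReal.sum_le_tsum _
  calc l1norm v r (subst a f)
      ≤ ∑' e, ∑' d, eabs v (coeff d f) * eabs v (coeff e (d.prod fun s k => a s ^ k)) *
          radiusPow r e := by
        refine ENNReal.tsum_le_tsum fun e => ?_
        rw [ENNReal.tsum_mul_right]
        exact mul_le_mul_left (h1 e) _
    _ = ∑' d, eabs v (coeff d f) * l1norm v r (d.prod fun s k => a s ^ k) := by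
        rw [ENNReal.tsum_comm]
        refine tsum_congr fun d => ?_
        rw [l1norm, ← ENNReal.tsum_mul_left]
        exact tsum_congr fun e => mul_assoc _ _ _
    _ ≤ _ := by
        refine ENNReal.tsum_le_tsum fun d => mul_le_mul_right ?_ _
        refine (l1norm_prod_le r _ _).trans ?_
        exact Finset.prod_le_prod' fun i _ => l1norm_pow_le r _ _

/-- Each monomial present has weight at least `k`, hence gains a factor at most `c ^ k`. This is the
source of all smallness below: shrinking the radii according to the weights makes a finite norm as
small as needed. -/
lemma l1norm_scale_le (r : σ → ℝ≥0∞) {c : ℝ≥0∞} (hc : c ≤ 1) (w : σ → ℕ) {k : ℕ}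
    {f : MvPowerSeries σ K} (hf : (k : ℕ∞) ≤ f.weightedOrder w) :
    l1norm v (fun i => c ^ w i * r i) f ≤ c ^ k * l1norm v r f := by
  rw [l1norm, l1norm, ← ENNReal.tsum_mul_left]
  refine ENNReal.tsum_le_tsum fun d => ?_
  by_cases hd : coeff d f = 0
  · simp [hd]
  · have hk : k ≤ Finsupp.weight w d := by
      exact_mod_cast hf.trans (weightedOrder_le w hd)
    rw [radiusPow_scale, ← mul_assoc, ← mul_assoc, mul_comm (eabs v _)]
    exact mul_le_mul_left (mul_le_mul_left (pow_le_pow_right_of_le_one' hc hk) _) _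

/-- Lower semicontinuity of the norm under coefficientwise approximation. -/
lemma l1norm_le_of_forall_finset (r : σ → ℝ≥0∞) (B : ℝ≥0∞) (f : MvPowerSeries σ K)
    (h : ∀ s : Finset (σ →₀ ℕ), ∃ g : MvPowerSeries σ K,
      l1norm v r g ≤ B ∧ ∀ d ∈ s, coeff d f = coeff d g) : l1norm v r f ≤ B := by
  rw [l1norm, ENNReal.tsum_eq_iSup_sum]
  refine iSup_le fun s => ?_
  obtain ⟨g, hg, hs⟩ := h s
  rw [Finset.sum_congr rfl fun d hd => by rw [hs d hd]]
  exact (ENNReal.sum_le_tsum s).trans hg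

/-- If every coefficient of `f` is `0` or a coefficient of `g` at a shifted index, the norm of `f`
is bounded by that of `g`. -/
lemma radiusPow_mul_l1norm_le_of_shift {r : τ → ℝ≥0∞} {s : σ → ℝ≥0∞} (f : MvPowerSeries σ K)
    (g : MvPowerSeries τ K) (c : ℝ≥0∞) (e : (σ →₀ ℕ) → (τ →₀ ℕ)) (he : Function.Injective e)
    (hr : ∀ d, radiusPow r (e d) = c * radiusPow s d)
    (hfg : ∀ d, coeff d f = 0 ∨ coeff d f = coeff (e d) g) :
    c * l1norm v s f ≤ l1norm v r g := by
  rw [l1norm, ← ENNReal.tsum_mul_left]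
  calc _ ≤ ∑' d, eabs v (coeff (e d) g) * radiusPow r (e d) := by
        refine ENNReal.tsum_le_tsum fun d => ?_
        rw [hr]
        rcases hfg d with h | h
        · simp [h]
        · rw [h]; exact le_of_eq (by ring)
    _ ≤ _ := ENNReal.tsum_comp_le_tsum_of_injective he
        (fun d => eabs v (coeff d g) * radiusPow r d)

end MvPowerSeries

/-! ### Substitution homomorphisms and the algebra of convergent series. -/

namespace MvPowerSeries

variable {K : Type*} [Field K] {σ τ ρ : Type}

/-- The algebra homomorphism substituting series without constant term for the variables
(the homomorphism substituting zero if one of the series has a constant term). -/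
noncomputable def substHom [Finite σ] (a : σ → MvPowerSeries τ K) :
    MvPowerSeries σ K →ₐ[K] MvPowerSeries τ K :=
  open Classical in
  if h : ∀ i, constantCoeff (a i) = 0 then substAlgHom (hasSubst_of_constantCoeff_zero h)
  else substAlgHom HasSubst.zero

section SubstHom

variable [Finite σ]

lemma substHom_eq {a : σ → MvPowerSeries τ K} (ha : ∀ i, constantCoeff (a i) = 0)
    (f : MvPowerSeries σ K) : substHom a f = subst a f := by
  rw [substHom, dif_pos ha, coe_substAlgHom]

lemma substHom_X {a : σ → MvPowerSeries τ K} (ha : ∀ i, constantCoeff (a i) = 0) (i : σ) :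
    substHom a (X i) = a i := by
  rw [substHom_eq ha, subst_X (hasSubst_of_constantCoeff_zero ha)]

@[simp] lemma substHom_C (a : σ → MvPowerSeries τ K) (c : K) :
    substHom a (C c) = C c := by
  have : (C c : MvPowerSeries σ K) = algebraMap K _ c := rfl
  rw [this, AlgHom.commutes]
  rfl

lemma substHom_substHom [Finite τ] {a : σ → MvPowerSeries τ K} {b : τ → MvPowerSeries ρ K}
    (ha : ∀ i, constantCoeff (a i) = 0) (hb : ∀ i, constantCoeff (b i) = 0)
    (f : MvPowerSeries σ K) :
    substHom b (substHom a f) = substHom (fun i => substHom b (a i)) f := by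
  have hc : ∀ i, constantCoeff (substHom b (a i)) = 0 := fun i => by
    rw [substHom_eq hb]
    exact constantCoeff_subst_eq_zero (hasSubst_of_constantCoeff_zero hb) hb (ha i)
  rw [substHom_eq ha, substHom_eq hb, substHom_eq hc,
    subst_comp_subst_apply (hasSubst_of_constantCoeff_zero ha) (hasSubst_of_constantCoeff_zero hb)]
  simp_rw [substHom_eq hb]

lemma substHom_X_eq (f : MvPowerSeries σ K) : substHom X f = f := by
  rw [substHom_eq (fun i => constantCoeff_X i), subst_self, id]

-- No hypothesis on `a` is needed, because the default substitution by zero also preserves constant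
-- terms.
@[simp] lemma constantCoeff_substHom (a : σ → MvPowerSeries τ K)
    (f : MvPowerSeries σ K) : constantCoeff (substHom a f) = constantCoeff f := by
  have key : ∀ g : MvPowerSeries σ K, constantCoeff g = 0 → constantCoeff (substHom a g) = 0 := by
    intro g hg
    rw [substHom]
    split_ifs with ha
    · rw [coe_substAlgHom]
      exact constantCoeff_subst_eq_zero (hasSubst_of_constantCoeff_zero ha) ha hg
    · rw [coe_substAlgHom]
      exact constantCoeff_subst_eq_zero HasSubst.zero (fun i => map_zero _) hg
  have h := key (f - C (constantCoeff f)) (by simp)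
  rw [map_sub, map_sub, substHom_C, constantCoeff_C, sub_eq_zero] at h
  exact h

lemma substHom_rename [Finite τ] {a : τ → MvPowerSeries ρ K} (ha : ∀ i, constantCoeff (a i) = 0)
    (e : σ → τ) (f : MvPowerSeries σ K) :
    substHom a (substHom (fun i => X (e i)) f) = substHom (fun i => a (e i)) f := by
  rw [substHom_substHom (fun i => constantCoeff_X _) ha]
  simp_rw [substHom_X ha]

end SubstHom

variable (v : AbsoluteValue K ℝ)

/-- The algebra of convergent power series. -/
def convergent (σ : Type) : Subalgebra K (MvPowerSeries σ K) where
  carrier := {f | ∃ r : σ → ℝ≥0∞, (∀ i, 0 < r i) ∧ l1norm v r f < ∞}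
  mul_mem' := by
    rintro f g ⟨r, hr, hf⟩ ⟨s, hs, hg⟩
    refine ⟨fun i => min (r i) (s i), fun i => lt_min (hr i) (hs i), ?_⟩
    refine (l1norm_mul_le _ _ _).trans_lt (ENNReal.mul_lt_top ?_ ?_)
    · exact (l1norm_mono (fun i => min_le_left _ _) f).trans_lt hf
    · exact (l1norm_mono (fun i => min_le_right _ _) g).trans_lt hg
  add_mem' := by
    rintro f g ⟨r, hr, hf⟩ ⟨s, hs, hg⟩
    refine ⟨fun i => min (r i) (s i), fun i => lt_min (hr i) (hs i), ?_⟩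
    refine (l1norm_add_le _ _ _).trans_lt (ENNReal.add_lt_top.2 ⟨?_, ?_⟩)
    · exact (l1norm_mono (fun i => min_le_left _ _) f).trans_lt hf
    · exact (l1norm_mono (fun i => min_le_right _ _) g).trans_lt hg
  algebraMap_mem' c := ⟨fun _ => 1, fun _ => one_pos, by
    change l1norm v _ (C c) < ∞
    rw [l1norm_C]; exact eabs_lt_top v c⟩

variable {v}

lemma C_mem_convergent (c : K) : C c ∈ convergent v σ := (convergent v σ).algebraMap_mem c

lemma X_mem_convergent (i : σ) : X i ∈ convergent v σ :=
  ⟨fun _ => 1, fun _ => one_pos, by rw [l1norm_X]; exact ENNReal.one_lt_top⟩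

lemma exists_pos_le_of_finite {ι : Type*} [Finite ι] {f : ι → ℝ≥0∞} (hf : ∀ i, 0 < f i) :
    ∃ c : ℝ≥0∞, 0 < c ∧ c ≤ 1 ∧ ∀ i, c ≤ f i := by
  cases isEmpty_or_nonempty ι
  · exact ⟨1, one_pos, le_rfl, fun i => isEmptyElim i⟩
  · obtain ⟨j, hj⟩ := Finite.exists_min f
    exact ⟨min 1 (f j), lt_min one_pos (hf j), min_le_left _ _,
      fun i => (min_le_right _ _).trans (hj i)⟩

/-- A finite family of convergent series has a common finite polyradius of convergence. -/
lemma exists_common_radius {ι : Type*} [Finite ι] {f : ι → MvPowerSeries σ K}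
    (hf : ∀ i, f i ∈ convergent v σ) :
    ∃ r : σ → ℝ≥0∞, (∀ i, 0 < r i) ∧ (∀ i, r i < ∞) ∧ ∀ j, l1norm v r (f j) < ∞ := by
  choose r hr h using hf
  choose c hc hc1 hcr using fun i => exists_pos_le_of_finite fun j => hr j i
  exact ⟨c, hc, fun i => (hc1 i).trans_lt ENNReal.one_lt_top,
    fun j => (l1norm_mono (fun i => hcr i j) _).trans_lt (h j)⟩

lemma exists_pos_mul_le {B ε : ℝ≥0∞} (hB : B < ∞) (hε : 0 < ε) :
    ∃ c : ℝ≥0∞, 0 < c ∧ c ≤ 1 ∧ c * B ≤ ε := by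
  rcases eq_or_ne B 0 with rfl | hB0
  · exact ⟨1, one_pos, le_rfl, by simp⟩
  · refine ⟨min 1 (ε / B), lt_min one_pos (ENNReal.div_pos hε.ne' hB.ne), min_le_left _ _, ?_⟩
    calc _ ≤ ε / B * B := mul_le_mul_left (min_le_right _ _) _
      _ ≤ ε := ENNReal.mul_le_of_le_div le_rfl

/-- The inner series have no constant term, so scaling their radii by `c₀` scales their norms by at
most `c₀` and brings them below the radii at which `f` converges. -/
lemma substHom_mem_convergent [Finite σ] [Finite τ] {a : σ → MvPowerSeries τ K}
    (ha : ∀ i, constantCoeff (a i) = 0) (hac : ∀ i, a i ∈ convergent v τ)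
    {f : MvPowerSeries σ K} (hf : f ∈ convergent v σ) : substHom a f ∈ convergent v τ := by
  obtain ⟨s, hs, hfs⟩ := hf
  obtain ⟨r, hr, hr', har⟩ := exists_common_radius hac
  have h : ∀ i, ∃ c : ℝ≥0∞, 0 < c ∧ c ≤ 1 ∧ c * l1norm v r (a i) ≤ s i :=
    fun i => exists_pos_mul_le (har i) (hs i)
  choose c hc hc1 hcs using h
  obtain ⟨c₀, hc₀, hc₀1, hc₀c⟩ := exists_pos_le_of_finite hc
  refine ⟨fun i => c₀ ^ 1 * r i, fun i => ?_, ?_⟩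
  · exact ENNReal.mul_pos (pow_ne_zero _ hc₀.ne') (hr i).ne'
  · rw [substHom_eq ha]
    refine (l1norm_subst_le _ (hasSubst_of_constantCoeff_zero ha) f).trans_lt
      ((l1norm_mono (fun i => ?_) f).trans_lt hfs)
    refine (l1norm_scale_le r hc₀1 (fun _ => 1) (k := 1) ?_).trans ?_
    · exact Order.one_le_iff_ne_zero.2 (order_ne_zero_iff_constCoeff_eq_zero.2 (ha i))
    · rw [pow_one]
      exact le_trans (mul_le_mul_left (hc₀c i) _) (hcs i)

/-- With finitely many variables a polyradius may be replaced by a positive lower bound common to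
its entries, taken at most `1` so that it is a real number. -/
lemma isConvergent_iff_mem_convergent [Finite σ] {f : MvPowerSeries σ K} :
    f.IsConvergent v ↔ f ∈ convergent v σ := by
  have hpow : ∀ (r : ℝ≥0∞) (d : σ →₀ ℕ), radiusPow (fun _ => r) d = r ^ d.degree := by
    intro r d
    rw [radiusPow, Finsupp.prod, Finset.prod_pow_eq_pow_sum]
    rfl
  constructor
  · rintro ⟨r, hr, hs⟩
    refine ⟨fun _ => ENNReal.ofReal r, fun _ => ENNReal.ofReal_pos.2 hr, ?_⟩
    have h := hs.tsum_ofReal_lt_top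
    convert h using 1
    refine tsum_congr fun d => ?_
    rw [hpow, ENNReal.ofReal_mul (v.nonneg _), ENNReal.ofReal_pow hr.le, eabs]
  · rintro ⟨r, hr, hs⟩
    obtain ⟨s, hs0, hs1, hsr⟩ := exists_pos_le_of_finite hr
    have hst : s ≠ ∞ := (hs1.trans_lt ENNReal.one_lt_top).ne
    refine ⟨s.toReal, ENNReal.toReal_pos hs0.ne' hst, ?_⟩
    have h : l1norm v (fun _ => s) f < ∞ :=
      (l1norm_mono hsr f).trans_lt hs
    have h2 := ENNReal.summable_toReal h.ne
    convert h2 using 2 with d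
    rw [hpow, ENNReal.toReal_mul, eabs, ENNReal.toReal_ofReal (v.nonneg _), ENNReal.toReal_pow]

end MvPowerSeries

/-! ### Fixed points of contractions for weight filtrations. -/

namespace MvPowerSeries

variable {K : Type*} [Field K] {σ τ ρ : Type}

section FixedPoint

variable {w : σ → ℕ}

lemma coeff_eq_of_le_weightedOrder_sub {f g : MvPowerSeries σ K} {k : ℕ}
    (h : (k : ℕ∞) ≤ (f - g).weightedOrder w) {d : σ →₀ ℕ} (hd : Finsupp.weight w d < k) :
    coeff d f = coeff d g := by
  rw [← sub_eq_zero, ← map_sub]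
  exact coeff_eq_zero_of_lt_weightedOrder w (lt_of_lt_of_le (by exact_mod_cast hd) h)

lemma eq_of_forall_le_weightedOrder_sub {f g : MvPowerSeries σ K}
    (h : ∀ k : ℕ, (k : ℕ∞) ≤ (f - g).weightedOrder w) : f = g := by
  ext d
  exact coeff_eq_of_le_weightedOrder_sub (h _) (Nat.lt_succ_self _)

lemma le_weightedOrder_sub_comm {f g : MvPowerSeries σ K} {k : ℕ∞}
    (h : k ≤ (f - g).weightedOrder w) : k ≤ (g - f).weightedOrder w := by
  rwa [← neg_sub, weightedOrder_neg]

lemma le_weightedOrder_add {f g : MvPowerSeries σ K} {k : ℕ∞}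
    (hf : k ≤ f.weightedOrder w) (hg : k ≤ g.weightedOrder w) : k ≤ (f + g).weightedOrder w :=
  (le_min hf hg).trans (min_weightedOrder_le_add w)

lemma le_weightedOrder_sub {f g : MvPowerSeries σ K} {k : ℕ∞}
    (hf : k ≤ f.weightedOrder w) (hg : k ≤ g.weightedOrder w) : k ≤ (f - g).weightedOrder w := by
  rw [sub_eq_add_neg]
  exact le_weightedOrder_add hf (by rwa [weightedOrder_neg])

lemma le_weightedOrder_sum {ι : Type*} {s : Finset ι} {f : ι → MvPowerSeries σ K} {k : ℕ∞}
    (hf : ∀ i ∈ s, k ≤ (f i).weightedOrder w) : k ≤ (∑ i ∈ s, f i).weightedOrder w := by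
  classical
  induction s using Finset.induction_on with
  | empty => simp
  | insert i s hi ih =>
    rw [Finset.sum_insert hi]
    exact le_weightedOrder_add (hf i (Finset.mem_insert_self _ _))
      (ih fun j hj => hf j (Finset.mem_insert_of_mem hj))

lemma le_weightedOrder_sub_trans {f g h : MvPowerSeries σ K} {k : ℕ∞}
    (hf : k ≤ (f - g).weightedOrder w) (hg : k ≤ (g - h).weightedOrder w) :
    k ≤ (f - h).weightedOrder w := by
  rw [← sub_add_sub_cancel f g h]
  exact le_weightedOrder_add hf hg

/-- A map on tuples of power series which is contracting for a weight filtration has a fixed point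
in every closed stable set. -/
theorem exists_fixedPoint_of_contracting {ι : Type*} (w : σ → ℕ)
    (S : Set (ι → MvPowerSeries σ K)) (Φ : (ι → MvPowerSeries σ K) → ι → MvPowerSeries σ K)
    (hne : S.Nonempty) (hmaps : ∀ z ∈ S, Φ z ∈ S)
    (hclosed : ∀ z, (∀ k : ℕ, ∃ z' ∈ S, ∀ i, (k : ℕ∞) ≤ (z i - z' i).weightedOrder w) → z ∈ S)
    (hcontr : ∀ z ∈ S, ∀ z' ∈ S, ∀ k : ℕ, (∀ i, (k : ℕ∞) ≤ (z i - z' i).weightedOrder w) →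
      ∀ i, ((k + 1 : ℕ) : ℕ∞) ≤ (Φ z i - Φ z' i).weightedOrder w) :
    ∃ z ∈ S, Φ z = z := by
  obtain ⟨z₀, hz₀⟩ := hne
  let a : ℕ → ι → MvPowerSeries σ K := fun k => Φ^[k] z₀
  have ha : ∀ k, a (k + 1) = Φ (a k) := fun k => Function.iterate_succ_apply' _ _ _
  have haS : ∀ k, a k ∈ S := by
    intro k
    induction k with
    | zero => exact hz₀
    | succ k ih => rw [ha]; exact hmaps _ ih
  have hstep : ∀ (k : ℕ) i, (k : ℕ∞) ≤ (a (k + 1) i - a k i).weightedOrder w := by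
    intro k
    induction k with
    | zero => simp
    | succ k ih =>
      intro i
      rw [ha (k + 1), ha k]
      exact hcontr _ (hmaps _ (haS k)) _ (haS k) k (fun i => by rw [← ha]; exact ih i) i
  have hle : ∀ k l : ℕ, k ≤ l → ∀ i, (k : ℕ∞) ≤ (a l i - a k i).weightedOrder w := by
    intro k l hkl i
    induction l, hkl using Nat.le_induction with
    | base => simp
    | succ l hl ih =>
      exact le_weightedOrder_sub_trans (le_trans (by exact_mod_cast hl) (hstep l i)) ih
  -- The coefficient at an exponent of weight `k` no longer changes from the iterate `k + 1` on.
  -- Finiteness of the set of exponents of given weight is not needed.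
  let z : ι → MvPowerSeries σ K := fun i d => coeff d (a (Finsupp.weight w d + 1) i)
  have hz : ∀ (k : ℕ) i, (k : ℕ∞) ≤ (z i - a k i).weightedOrder w := by
    intro k i
    refine nat_le_weightedOrder w fun d hd => ?_
    rw [map_sub, sub_eq_zero]
    exact (coeff_eq_of_le_weightedOrder_sub (hle (Finsupp.weight w d + 1) k hd i)
      (Nat.lt_succ_self _)).symm
  have hzS : z ∈ S := hclosed z fun k => ⟨a k, haS k, hz k⟩
  refine ⟨z, hzS, funext fun i => eq_of_forall_le_weightedOrder_sub (w := w) fun k => ?_⟩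
  refine le_weightedOrder_sub_trans (g := a (k + 1) i) ?_ ?_
  · rw [ha]
    exact le_trans (by exact_mod_cast Nat.le_succ k) (hcontr z hzS _ (haS k) k (hz k) i)
  · exact le_weightedOrder_sub_comm
      (le_trans (by exact_mod_cast Nat.le_succ k) (hz (k + 1) i))

theorem fixedPoint_unique_of_contracting {ι : Type*} (w : σ → ℕ)
    (S : Set (ι → MvPowerSeries σ K)) (Φ : (ι → MvPowerSeries σ K) → ι → MvPowerSeries σ K)
    (hcontr : ∀ z ∈ S, ∀ z' ∈ S, ∀ k : ℕ, (∀ i, (k : ℕ∞) ≤ (z i - z' i).weightedOrder w) →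
      ∀ i, ((k + 1 : ℕ) : ℕ∞) ≤ (Φ z i - Φ z' i).weightedOrder w)
    {z z' : ι → MvPowerSeries σ K} (hz : z ∈ S) (hz' : z' ∈ S) (h : Φ z = z) (h' : Φ z' = z') :
    z = z' := by
  have key : ∀ (k : ℕ) i, (k : ℕ∞) ≤ (z i - z' i).weightedOrder w := by
    intro k
    induction k with
    | zero => simp
    | succ k ih =>
      intro i
      have := hcontr z hz z' hz' k ih i
      rwa [h, h'] at this
  exact funext fun i => eq_of_forall_le_weightedOrder_sub (w := w) fun k => key k i

end FixedPoint

/-- The norm ball is closed for coefficientwise approximation. -/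
lemma l1norm_le_of_approx {v : AbsoluteValue K ℝ} (w : σ → ℕ) (r : σ → ℝ≥0∞) (B : ℝ≥0∞)
    (f : MvPowerSeries σ K)
    (h : ∀ k : ℕ, ∃ g : MvPowerSeries σ K, l1norm v r g ≤ B ∧
      (k : ℕ∞) ≤ (f - g).weightedOrder w) : l1norm v r f ≤ B := by
  refine l1norm_le_of_forall_finset r B f fun s => ?_
  obtain ⟨g, hg, hfg⟩ := h (s.sup (Finsupp.weight w) + 1)
  exact ⟨g, hg, fun d hd =>
    coeff_eq_of_le_weightedOrder_sub hfg (Nat.lt_succ_of_le (Finset.le_sup hd))⟩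

end MvPowerSeries

/-! ### Weierstrass division, formal and convergent. -/

namespace MvPowerSeries

variable {K : Type*} [Field K] {ρ : Type}

/-- The weight giving the distinguished variable weight `0` and all others weight `1`. -/
def someWeight : Option ρ → ℕ := fun o => o.elim 0 fun _ => 1

/-- The coefficient of the `j`-th power of the distinguished variable. -/
noncomputable def noneCoeff (j : ℕ) (f : MvPowerSeries (Option ρ) K) : MvPowerSeries ρ K :=
  PowerSeries.coeff j (optionEquivLeft ρ K f)

/-- Division by the `q`-th power of the distinguished variable, discarding the remainder. -/
noncomputable def noneShift (q : ℕ) (f : MvPowerSeries (Option ρ) K) :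
    MvPowerSeries (Option ρ) K :=
  fun d => coeff (d + Finsupp.single none q) f

lemma coeff_noneShift (q : ℕ) (f : MvPowerSeries (Option ρ) K) (d : Option ρ →₀ ℕ) :
    coeff d (noneShift q f) = coeff (d + Finsupp.single none q) f := rfl

lemma coeff_noneCoeff (j : ℕ) (f : MvPowerSeries (Option ρ) K) (d : ρ →₀ ℕ) :
    coeff d (noneCoeff j f) = coeff (d.optionElim j) f :=
  coeff_coeff_optionEquivLeft f j d

lemma noneShift_add (q : ℕ) (f g : MvPowerSeries (Option ρ) K) :
    noneShift q (f + g) = noneShift q f + noneShift q g := by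
  ext d
  simp only [coeff_noneShift, map_add]

lemma noneShift_sub (q : ℕ) (f g : MvPowerSeries (Option ρ) K) :
    noneShift q (f - g) = noneShift q f - noneShift q g := by
  ext d
  simp only [coeff_noneShift, map_sub]

lemma le_weightedOrder_noneShift (q : ℕ) {f : MvPowerSeries (Option ρ) K} {k : ℕ}
    (h : (k : ℕ∞) ≤ f.weightedOrder someWeight) :
    (k : ℕ∞) ≤ (noneShift q f).weightedOrder someWeight := by
  refine nat_le_weightedOrder _ fun d hd => ?_
  rw [coeff_noneShift]
  refine coeff_eq_zero_of_lt_weightedOrder someWeight (lt_of_lt_of_le ?_ h)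
  rw [map_add, Finsupp.weight_single]
  simpa [someWeight] using! hd

variable [Finite ρ]

/-- The inclusion of the power series not involving the distinguished variable. -/
noncomputable abbrev someEmb : MvPowerSeries ρ K →ₐ[K] MvPowerSeries (Option ρ) K :=
  substHom fun i => X (some i)

lemma optionEquivLeft_someEmb (f : MvPowerSeries ρ K) :
    optionEquivLeft ρ K (someEmb f) = PowerSeries.C f := by
  have hren : someEmb f = rename (Function.Embedding.some : ρ ↪ Option ρ) f := by
    rw [someEmb, substHom_eq (fun i => constantCoeff_X _), rename_eq_subst]
    rfl
  ext n d
  rw [coeff_coeff_optionEquivLeft, PowerSeries.coeff_C, hren]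
  split_ifs with hn
  · rw [hn]
    have : d.optionElim 0 = Finsupp.embDomain Function.Embedding.some d := by
      ext o
      cases o with
      | none =>
        rw [Finsupp.optionElim_apply_none, Finsupp.embDomain_of_notMem_range]
        simp
      | some a =>
        rw [Finsupp.optionElim_apply_some]
        exact (Finsupp.embDomain_apply_self Function.Embedding.some d a).symm
    rw [this, coeff_embDomain_rename]
  · rw [map_zero]
    refine coeff_rename_eq_zero _ _ ?_
    rintro ⟨x, hx⟩
    have := DFunLike.congr_fun hx none
    rw [Finsupp.optionElim_apply_none, Finsupp.mapDomain_of_notMem_range] at this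
    · exact hn this.symm
    · simp

lemma noneCoeff_sum (q : ℕ) (R : Fin q → MvPowerSeries ρ K) (j : Fin q) :
    noneCoeff (j : ℕ) (∑ i, someEmb (R i) * X none ^ (i : ℕ)) = R j := by
  rw [noneCoeff, map_sum, map_sum, Finset.sum_eq_single j]
  · rw [map_mul, map_pow, optionEquivLeft_someEmb, optionEquivLeft_X_none,
      PowerSeries.coeff_C_mul, PowerSeries.coeff_X_pow_self, mul_one]
  · intro i _ hij
    rw [map_mul, map_pow, optionEquivLeft_someEmb, optionEquivLeft_X_none,
      PowerSeries.coeff_C_mul, PowerSeries.coeff_X_pow, if_neg, mul_zero]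
    exact fun h => hij (Fin.ext h.symm)
  · simp

omit [Finite ρ] in
lemma optionEquivLeft_noneShift (q : ℕ) (f : MvPowerSeries (Option ρ) K) (n : ℕ) :
    PowerSeries.coeff n (optionEquivLeft ρ K (noneShift q f)) = noneCoeff (n + q) f := by
  ext d
  rw [coeff_coeff_optionEquivLeft, coeff_noneShift, coeff_noneCoeff]
  congr 2
  ext o
  cases o <;> simp

lemma noneShift_sum_eq_zero (q : ℕ) (R : Fin q → MvPowerSeries ρ K) :
    noneShift q (∑ i, someEmb (R i) * X none ^ (i : ℕ)) = 0 := by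
  apply (optionEquivLeft ρ K).injective
  ext1 n
  rw [optionEquivLeft_noneShift, map_zero, map_zero, noneCoeff, map_sum, map_sum]
  refine Finset.sum_eq_zero fun i _ => ?_
  rw [map_mul, map_pow, optionEquivLeft_someEmb, optionEquivLeft_X_none,
      PowerSeries.coeff_C_mul, PowerSeries.coeff_X_pow, if_neg, mul_zero]
  omega

omit [Finite ρ] in
lemma noneShift_X_pow_mul (q : ℕ) (f : MvPowerSeries (Option ρ) K) :
    noneShift q (X none ^ q * f) = f := by
  ext d
  rw [coeff_noneShift, X_pow_eq, add_comm, coeff_add_monomial_mul, one_mul]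

lemma eq_X_pow_mul_noneShift_add (q : ℕ) (f : MvPowerSeries (Option ρ) K) :
    f = X none ^ q * noneShift q f +
      ∑ j : Fin q, someEmb (noneCoeff (j : ℕ) f) * X none ^ (j : ℕ) := by
  apply (optionEquivLeft ρ K).injective
  ext1 n
  simp only [map_add, map_mul, map_pow, map_sum, optionEquivLeft_someEmb, optionEquivLeft_X_none,
    PowerSeries.coeff_C_mul, PowerSeries.coeff_X_pow, PowerSeries.coeff_X_pow_mul', mul_ite,
    mul_one, mul_zero]
  by_cases hn : q ≤ n
  · rw [if_pos hn, optionEquivLeft_noneShift, Nat.sub_add_cancel hn, Finset.sum_eq_zero, add_zero]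
    · rfl
    · intro i _
      rw [if_neg]
      omega
  · rw [if_neg hn, zero_add, Finset.sum_eq_single (⟨n, by omega⟩ : Fin q)]
    · simp [noneCoeff]
    · intro i _ hi
      rw [if_neg]
      exact fun h => hi (Fin.ext h.symm)
    · simp

section Division

variable {q : ℕ} {w : MvPowerSeries (Option ρ) K}

omit [Finite ρ] in
-- Dividing `g` by `X none ^ q - w` amounts to solving `Q = noneShift q (g + w * Q)`. Multiplication
-- by `w` raises the weight by at least one, and the shift does not lower it since the distinguished
-- variable has weight `0`.
lemma noneShift_contracting (hw : 1 ≤ w.weightedOrder someWeight)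
    (g : MvPowerSeries (Option ρ) K) {Q Q' : MvPowerSeries (Option ρ) K} {k : ℕ}
    (h : (k : ℕ∞) ≤ (Q - Q').weightedOrder someWeight) :
    ((k + 1 : ℕ) : ℕ∞) ≤
      (noneShift q (g + w * Q) - noneShift q (g + w * Q')).weightedOrder someWeight := by
  rw [← noneShift_sub]
  refine le_weightedOrder_noneShift q ?_
  rw [add_sub_add_left_eq_sub, ← mul_sub]
  refine le_trans ?_ (le_weightedOrder_mul _)
  rw [Nat.cast_add, Nat.cast_one, add_comm]
  exact add_le_add hw h

lemma division_of_fixedPoint {g Q : MvPowerSeries (Option ρ) K}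
    (hQ : noneShift q (g + w * Q) = Q) :
    g = (X none ^ q - w) * Q +
      ∑ j : Fin q, someEmb (noneCoeff (j : ℕ) (g + w * Q)) * X none ^ (j : ℕ) := by
  have h := eq_X_pow_mul_noneShift_add q (g + w * Q)
  rw [hQ] at h
  linear_combination h

/-- Weierstrass division for formal power series. -/
theorem exists_division (hw : 1 ≤ w.weightedOrder someWeight)
    (g : MvPowerSeries (Option ρ) K) :
    ∃ (Q : MvPowerSeries (Option ρ) K) (R : Fin q → MvPowerSeries ρ K),
      g = (X none ^ q - w) * Q + ∑ j : Fin q, someEmb (R j) * X none ^ (j : ℕ) := by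
  obtain ⟨Q, -, hQ⟩ := exists_fixedPoint_of_contracting (ι := Unit) someWeight Set.univ
    (fun Q _ => noneShift q (g + w * Q ())) ⟨0, trivial⟩ (fun _ _ => trivial) (fun _ _ => trivial)
    (fun Q _ Q' _ k h _ => noneShift_contracting hw g (h ()))
  exact ⟨Q (), _, division_of_fixedPoint (congrFun hQ ())⟩

/-- Uniqueness in Weierstrass division. -/
theorem division_unique (hw : 1 ≤ w.weightedOrder someWeight)
    {Q : MvPowerSeries (Option ρ) K} {R : Fin q → MvPowerSeries ρ K}
    (h : (X none ^ q - w) * Q + ∑ j : Fin q, someEmb (R j) * X none ^ (j : ℕ) = 0) :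
    Q = 0 ∧ ∀ j, R j = 0 := by
  have hQ : Q = 0 := by
    have h1 : X none ^ q * Q + ∑ j : Fin q, someEmb (R j) * X none ^ (j : ℕ) = 0 + w * Q := by
      linear_combination h
    have h2 := congrArg (noneShift q) h1
    rw [noneShift_add, noneShift_X_pow_mul, noneShift_sum_eq_zero, add_zero] at h2
    -- Both `Q` and `0` are fixed points of the division map with dividend zero.
    have := fixedPoint_unique_of_contracting (ι := Unit) someWeight Set.univ
      (fun Q _ => noneShift q (0 + w * Q ()))
      (fun Q _ Q' _ k h _ => noneShift_contracting hw 0 (h ()))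
      (z := fun _ => Q) (z' := fun _ => 0) trivial trivial
      (funext fun _ => h2.symm) (funext fun _ => by ext d; simp [coeff_noneShift])
    exact congrFun this ()
  refine ⟨hQ, fun j => ?_⟩
  rw [hQ, mul_zero, zero_add] at h
  rw [← noneCoeff_sum q R j, h]
  simp [noneCoeff]

variable {v : AbsoluteValue K ℝ}

omit [Finite ρ] in
lemma l1norm_noneShift_le (r : Option ρ → ℝ≥0∞) (q : ℕ) (f : MvPowerSeries (Option ρ) K) :
    r none ^ q * l1norm v r (noneShift q f) ≤ l1norm v r f :=
  radiusPow_mul_l1norm_le_of_shift _ f _ (fun d => d + Finsupp.single none q)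
    (fun _ _ h => add_right_cancel h)
    (fun d => by rw [radiusPow_add, radiusPow_single, mul_comm]) (fun _ => Or.inr rfl)

omit [Finite ρ] in
lemma radiusPow_optionElim (r : Option ρ → ℝ≥0∞) (j : ℕ) (d : ρ →₀ ℕ) :
    radiusPow r (d.optionElim j) = r none ^ j * radiusPow (fun i => r (some i)) d := by
  classical
  rw [radiusPow, Finsupp.prod_option_index _ _ (by simp) (fun _ _ _ => pow_add _ _ _)]
  simp [radiusPow]

omit [Finite ρ] in
lemma l1norm_noneCoeff_le (r : Option ρ → ℝ≥0∞) (j : ℕ) (f : MvPowerSeries (Option ρ) K) :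
    r none ^ j * l1norm v (fun i => r (some i)) (noneCoeff j f) ≤ l1norm v r f :=
  radiusPow_mul_l1norm_le_of_shift _ f _ (fun d => d.optionElim j)
    (fun d e h => by
      have := congrArg Finsupp.some h
      simpa using this)
    (radiusPow_optionElim r j) (fun d => Or.inr (coeff_noneCoeff j f d))

omit [Finite ρ] in
lemma noneCoeff_mem_convergent {f : MvPowerSeries (Option ρ) K}
    (hf : f ∈ convergent v (Option ρ)) (j : ℕ) : noneCoeff j f ∈ convergent v ρ := by
  obtain ⟨r, hr, -, h⟩ := exists_common_radius (ι := Unit) (f := fun _ => f) fun _ => hf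
  refine ⟨fun i => r (some i), fun i => hr _, ?_⟩
  by_contra hc
  rw [not_lt, top_le_iff] at hc
  have := l1norm_noneCoeff_le (v := v) r j f
  rw [hc, ENNReal.mul_top (pow_ne_zero _ (hr none).ne')] at this
  exact (h ()).ne (top_le_iff.1 this)

/-- Weierstrass division of convergent power series. -/
theorem exists_division_convergent (hw : 1 ≤ w.weightedOrder someWeight)
    (hwc : w ∈ convergent v (Option ρ)) {g : MvPowerSeries (Option ρ) K}
    (hg : g ∈ convergent v (Option ρ)) :
    ∃ Q ∈ convergent v (Option ρ), ∃ R : Fin q → MvPowerSeries ρ K,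
      (∀ j, R j ∈ convergent v ρ) ∧
      g = (X none ^ q - w) * Q + ∑ j : Fin q, someEmb (R j) * X none ^ (j : ℕ) := by
  obtain ⟨r, hr, hr', h⟩ := exists_common_radius (v := v) (f := ![w, g])
    (by simpa [Fin.forall_fin_two] using ⟨hwc, hg⟩)
  have hrw := h 0
  have hrg := h 1
  simp only [Matrix.cons_val_zero, Matrix.cons_val_one] at hrw hrg
  have hq0 : r none ^ q ≠ 0 := pow_ne_zero _ (hr none).ne'
  have hqt : r none ^ q ≠ ∞ := ENNReal.pow_ne_top (hr' none).ne
  -- Only the radii of the variables of weight one are shrunk: the factor `r none ^ q` lost by the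
  -- shift stays fixed, while the norm of `w` drops to at most half of it.
  obtain ⟨c, hc, hc1, hcw⟩ := exists_pos_mul_le hrw
    (ENNReal.half_pos hq0 : 0 < r none ^ q / 2)
  set s : Option ρ → ℝ≥0∞ := fun i => c ^ someWeight i * r i
  have hs : ∀ i, 0 < s i := fun i => ENNReal.mul_pos (pow_ne_zero _ hc.ne') (hr i).ne'
  have hsr : ∀ i, s i ≤ r i := fun i => mul_le_of_le_one_left' (pow_le_one' hc1 _)
  have hsn : s none = r none := by simp [s, someWeight]
  have hsw : l1norm v s w ≤ r none ^ q / 2 := by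
    refine (l1norm_scale_le r hc1 someWeight (k := 1) (by exact_mod_cast hw)).trans ?_
    rwa [pow_one]
  -- With this radius the dividend and the term `w * Q` each contribute at most `B / 2`, so the ball
  -- is stable.
  set B : ℝ≥0∞ := 2 * (l1norm v s g / r none ^ q)
  have hsg : l1norm v s g < ∞ := (l1norm_mono hsr g).trans_lt hrg
  have hB : B < ∞ := ENNReal.mul_lt_top (by simp) (ENNReal.div_lt_top hsg.ne hq0)
  obtain ⟨Q, hQB, hQ⟩ := exists_fixedPoint_of_contracting (ι := Unit) someWeight
    {Q | l1norm v s (Q ()) ≤ B} (fun Q _ => noneShift q (g + w * Q ()))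
    ⟨0, by simp [l1norm_zero]⟩
    (fun Q (hQ : l1norm v s (Q ()) ≤ B) => by
      change l1norm v s (noneShift q (g + w * Q ())) ≤ B
      have h1 : r none ^ q * l1norm v s (noneShift q (g + w * Q ())) ≤ r none ^ q * B := by
        rw [← hsn]
        refine (l1norm_noneShift_le s q _).trans ?_
        rw [hsn]
        calc _ ≤ l1norm v s g + r none ^ q / 2 * B :=
              (l1norm_add_le _ _ _).trans (add_le_add le_rfl
                ((l1norm_mul_le _ _ _).trans (mul_le_mul' hsw hQ)))
          _ = r none ^ q * (B / 2) + r none ^ q * (B / 2) := by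
              congr 1
              · simp only [B]
                rw [mul_comm 2, ENNReal.mul_div_cancel_right (by simp) (by simp),
                  ENNReal.mul_div_cancel hq0 hqt]
              · rw [div_eq_mul_inv, div_eq_mul_inv]; ring
          _ = r none ^ q * B := by rw [← mul_add, ENNReal.add_halves]
      exact (ENNReal.mul_le_mul_iff_right hq0 hqt).1 h1)
    (fun z hz => l1norm_le_of_approx someWeight s B _ fun k => by
      obtain ⟨z', hz', h⟩ := hz k
      exact ⟨z' (), hz', h ()⟩)
    (fun Q _ Q' _ k h _ => noneShift_contracting hw g (h ()))
  have hQc : Q () ∈ convergent v (Option ρ) := ⟨s, hs, lt_of_le_of_lt hQB hB⟩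
  exact ⟨Q (), hQc, _, fun j => noneCoeff_mem_convergent
    (add_mem hg (mul_mem hwc hQc)) _, division_of_fixedPoint (congrFun hQ ())⟩

end Division

end MvPowerSeries

/-! ### The chain rule and Taylor's formula. -/

namespace MvPowerSeries

variable {K : Type*} [Field K] {σ τ : Type}

section ChainRule

lemma le_order_substHom [Finite σ] {a : σ → MvPowerSeries τ K}
    (ha : ∀ i, constantCoeff (a i) = 0) {f : MvPowerSeries σ K} {k : ℕ∞} (h : k ≤ f.order) :
    k ≤ (substHom a f).order := by
  rw [substHom_eq ha]
  refine le_trans ?_ (le_order_subst (hasSubst_of_constantCoeff_zero ha) f)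
  have : (1 : ℕ∞) ≤ ⨅ i, (a i).order :=
    le_iInf fun i => Order.one_le_iff_ne_zero.2 (order_ne_zero_iff_constCoeff_eq_zero.2 (ha i))
  calc k ≤ 1 * f.order := by rwa [one_mul]
    _ ≤ _ := mul_le_mul_left this _

lemma le_order_pderiv {f : MvPowerSeries σ K} {k : ℕ} (h : ((k + 1 : ℕ) : ℕ∞) ≤ f.order) (i : σ) :
    (k : ℕ∞) ≤ (pderiv K i f).order := by
  refine nat_le_order fun d hd => ?_
  rw [coeff_pderiv, coeff_of_lt_order, zero_mul]
  refine lt_of_lt_of_le ?_ h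
  rw [map_add, Finsupp.degree_single]
  exact_mod_cast Nat.succ_lt_succ hd

/-- The chain rule for substitution in power series. -/
theorem pderiv_substHom [Fintype σ] {a : σ → MvPowerSeries τ K}
    (ha : ∀ i, constantCoeff (a i) = 0) (j : τ) (f : MvPowerSeries σ K) :
    pderiv K j (substHom a f) = ∑ i, substHom a (pderiv K i f) * pderiv K j (a i) := by
  classical
  have hpoly : ∀ p : MvPolynomial σ K, pderiv K j (substHom a (p : MvPowerSeries σ K)) =
      ∑ i, substHom a (pderiv K i (p : MvPowerSeries σ K)) * pderiv K j (a i) := by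
    intro p
    induction p using MvPolynomial.induction_on with
    | C c => simp
    | add p q hp hq =>
      simp only [MvPolynomial.coe_add, map_add, hp, hq, add_mul, Finset.sum_add_distrib]
    | mul_X p i hp =>
      simp only [MvPolynomial.coe_mul, MvPolynomial.coe_X, map_mul, substHom_X ha,
        Derivation.leibniz, smul_eq_mul, hp, map_add, add_mul, Finset.sum_add_distrib]
      congr 1
      · rw [Finset.sum_eq_single i]
        · simp
        · intro k _ hk
          rw [pderiv_X_of_ne hk.symm]
          simp
        · simp
      · rw [Finset.mul_sum]
        exact Finset.sum_congr rfl fun k _ => by ring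
  ext e
  -- Differentiation lowers the order by one, so truncating at degree `e.degree + 2` leaves a
  -- remainder that does not affect the coefficient at `e`.
  set p : MvPolynomial σ K := truncTotal (e.degree + 2) f
  have hr : ((e.degree + 2 : ℕ) : ℕ∞) ≤ (f - (p : MvPowerSeries σ K)).order := by
    refine nat_le_order fun d hd => ?_
    rw [map_sub, MvPolynomial.coeff_coe, coeff_truncTotal _ hd, sub_self]
  have hlt : ((e.degree : ℕ) : ℕ∞) < ((e.degree + 1 : ℕ) : ℕ∞) := by exact_mod_cast Nat.lt_succ_self _
  have h1 : coeff e (pderiv K j (substHom a (f - (p : MvPowerSeries σ K)))) = 0 :=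
    coeff_of_lt_order (hlt.trans_le (le_order_pderiv (le_order_substHom ha hr) j))
  have h2 : coeff e (∑ i, substHom a (pderiv K i (f - (p : MvPowerSeries σ K))) *
      pderiv K j (a i)) = 0 := by
    rw [map_sum]
    refine Finset.sum_eq_zero fun i _ => coeff_of_lt_order (hlt.trans_le ?_)
    exact (le_order_substHom ha (le_order_pderiv hr i)).trans
      ((le_add_right le_rfl).trans le_order_mul)
  have h3 := congrArg (coeff e) (hpoly p)
  have hf : f = (f - (p : MvPowerSeries σ K)) + (p : MvPowerSeries σ K) := by ring
  conv_lhs => rw [hf, map_add, map_add, map_add, h1, h3]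
  conv_rhs => rw [hf]
  simp only [map_add, add_mul, Finset.sum_add_distrib, h2]

end ChainRule

section Taylor

variable [Fintype σ] [Fintype τ]

/-- A power series without monomials in the second group of variables is a power series in the
first group. -/
lemma substHom_inl_zero_of_coeff {f : MvPowerSeries (σ ⊕ τ) K}
    (hf : ∀ d : σ ⊕ τ →₀ ℕ, (∃ k, d (Sum.inr k) ≠ 0) → coeff d f = 0) :
    substHom (Sum.elim (fun i => X (Sum.inl i)) 0) f = f := by
  classical
  have h0 : ∀ i, constantCoeff ((Sum.elim (fun i => X (Sum.inl i)) 0 :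
      σ ⊕ τ → MvPowerSeries (σ ⊕ τ) K) i) = 0 := by
    rintro (i | i) <;> simp
  ext e
  have hmon : ∀ d : σ ⊕ τ →₀ ℕ, (∀ k, d (Sum.inr k) = 0) →
      (d.prod fun s k => (Sum.elim (fun i => X (Sum.inl i)) 0 :
        σ ⊕ τ → MvPowerSeries (σ ⊕ τ) K) s ^ k) = monomial d 1 := by
    intro d hd
    rw [MvPowerSeries.monomial_one_eq]
    refine Finset.prod_congr rfl fun i hi => ?_
    rcases i with i | i
    · rfl
    · exact absurd (hd i) (Finsupp.mem_support_iff.1 hi)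
  rw [substHom_eq h0, coeff_subst (hasSubst_of_constantCoeff_zero h0), finsum_eq_single _ e]
  · by_cases he : ∃ k, e (Sum.inr k) ≠ 0
    · simp [hf e he]
    · push Not at he
      rw [hmon e he]
      simp
  · intro d hd
    by_cases he : ∃ k, d (Sum.inr k) ≠ 0
    · simp [hf d he]
    · push Not at he
      rw [hmon d he, coeff_monomial_ne hd.symm, smul_zero]

lemma coeff_X_mul_ite {ρ : Type} (i : ρ) (g : MvPowerSeries ρ K) (d : ρ →₀ ℕ) :
    (d i = 0 → coeff d (X i * g) = 0) ∧
      (d i ≠ 0 → coeff d (X i * g) = coeff (d - Finsupp.single i 1) g) := by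
  classical
  constructor
  · intro h
    exact (X_dvd_iff.1 (Dvd.intro g rfl)) d h
  · intro h
    have : d = Finsupp.single i 1 + (d - Finsupp.single i 1) := by
      rw [add_tsub_cancel_of_le]
      exact Finsupp.single_le_iff.2 (Nat.one_le_iff_ne_zero.2 h)
    conv_lhs => rw [this, X, coeff_add_monomial_mul, one_mul]

variable {v : AbsoluteValue K ℝ}

/-- Hadamard's lemma: the difference between a power series and its value where a group of
variables vanishes is a combination of these variables. -/
theorem exists_eq_add_sum_X_mul (F : MvPowerSeries (σ ⊕ τ) K) :
    ∃ G : τ → MvPowerSeries (σ ⊕ τ) K,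
      (F ∈ convergent v (σ ⊕ τ) → ∀ k, G k ∈ convergent v (σ ⊕ τ)) ∧
      F = substHom (Sum.elim (fun i => X (Sum.inl i)) 0) F + ∑ k, X (Sum.inr k) * G k := by
  classical
  -- Each monomial involving the second group is assigned to one variable of that group dividing it.
  -- `G k` collects the monomials assigned to `k`, divided by that variable, so its coefficients are
  -- coefficients of `F` or zero and convergence is inherited.
  let κ : (σ ⊕ τ →₀ ℕ) → Option τ := fun d =>
    if h : ∃ k, d (Sum.inr k) ≠ 0 then some h.choose else none
  have hκ : ∀ d k, κ d = some k → d (Sum.inr k) ≠ 0 := by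
    intro d k h
    simp only [κ] at h
    split_ifs at h with h'
    · rw [← Option.some.inj h]
      exact h'.choose_spec
  have hκ' : ∀ d : σ ⊕ τ →₀ ℕ, (∃ k, d (Sum.inr k) ≠ 0) → ∃ k, κ d = some k := by
    intro d h
    exact ⟨h.choose, by simp only [κ]; rw [dif_pos h]⟩
  let G : τ → MvPowerSeries (σ ⊕ τ) K := fun k e =>
    if κ (e + Finsupp.single (Sum.inr k) 1) = some k then
      coeff (e + Finsupp.single (Sum.inr k) 1) F else 0
  have hG : ∀ k e, coeff e (G k) = if κ (e + Finsupp.single (Sum.inr k) 1) = some k then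
      coeff (e + Finsupp.single (Sum.inr k) 1) F else 0 := fun _ _ => rfl
  have hcoeff : ∀ k d, coeff d (X (Sum.inr k) * G k) = if κ d = some k then coeff d F else 0 := by
    intro k d
    by_cases hd : d (Sum.inr k) = 0
    · rw [(coeff_X_mul_ite _ _ _).1 hd, if_neg]
      exact fun h => hκ d k h hd
    · rw [(coeff_X_mul_ite _ _ _).2 hd, hG, tsub_add_cancel_of_le]
      exact Finsupp.single_le_iff.2 (Nat.one_le_iff_ne_zero.2 hd)
  have hsum : ∀ d : σ ⊕ τ →₀ ℕ, (∃ k, d (Sum.inr k) ≠ 0) →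
      coeff d (∑ k, X (Sum.inr k) * G k) = coeff d F := by
    intro d hd
    obtain ⟨k, hk⟩ := hκ' d hd
    rw [map_sum, Finset.sum_eq_single k]
    · rw [hcoeff, if_pos hk]
    · intro l _ hl
      rw [hcoeff, if_neg]
      rw [hk]
      exact fun h => hl (Option.some.inj h).symm
    · simp
  have h0 : ∀ i, constantCoeff ((Sum.elim (fun i => X (Sum.inl i)) 0 :
      σ ⊕ τ → MvPowerSeries (σ ⊕ τ) K) i) = 0 := by
    rintro (i | i) <;> simp
  refine ⟨G, ?_, ?_⟩
  · rintro ⟨r, hr, hF⟩ k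
    refine ⟨r, hr, ?_⟩
    have h1 : r (Sum.inr k) * l1norm v r (G k) ≤ l1norm v r F :=
      radiusPow_mul_l1norm_le_of_shift _ F _ (fun d => d + Finsupp.single (Sum.inr k) 1)
        (fun _ _ h => add_right_cancel h)
        (fun d => by rw [radiusPow_add, radiusPow_single, mul_comm, pow_one])
        (fun d => by rw [hG]; split_ifs <;> simp)
    by_contra hc
    rw [not_lt, top_le_iff] at hc
    rw [hc, ENNReal.mul_top (hr _).ne'] at h1
    exact hF.ne (top_le_iff.1 h1)
  · have h1 := substHom_inl_zero_of_coeff (f := F - ∑ k, X (Sum.inr k) * G k) (fun d hd => by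
      rw [map_sub, hsum d hd, sub_self])
    rw [map_sub, map_sum, Finset.sum_eq_zero, sub_zero] at h1
    · rw [h1]; ring
    · intro k _
      rw [map_mul, substHom_X h0]
      simp

lemma constantCoeff_add_eq_zero {α β : Type*} {a b : α → MvPowerSeries β K}
    (ha : ∀ i, constantCoeff (a i) = 0) (hb : ∀ i, constantCoeff (b i) = 0) (i : α) :
    constantCoeff (a i + b i) = 0 := by
  rw [map_add, ha, hb, add_zero]

lemma constantCoeff_sumElim_eq_zero {α β γ : Type*} {a : α → MvPowerSeries γ K}
    {b : β → MvPowerSeries γ K}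
    (ha : ∀ i, constantCoeff (a i) = 0) (hb : ∀ i, constantCoeff (b i) = 0) (i : α ⊕ β) :
    constantCoeff (Sum.elim a b i) = 0 := by
  cases i
  · exact ha _
  · exact hb _

omit [Fintype τ] in
/-- Taylor's formula of order two for power series. -/
theorem exists_taylor (v : AbsoluteValue K ℝ) (f : MvPowerSeries σ K) :
    ∃ q : σ → σ → MvPowerSeries (σ ⊕ σ) K,
      (f ∈ convergent v σ → ∀ k l, q k l ∈ convergent v (σ ⊕ σ)) ∧
      (f ∈ convergent v σ → ∀ k, pderiv K k f ∈ convergent v σ) ∧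
      ∀ {β : Type} [Finite β] (a b : σ → MvPowerSeries β K),
        (∀ i, constantCoeff (a i) = 0) → (∀ i, constantCoeff (b i) = 0) →
        substHom (fun i => a i + b i) f = substHom a f +
          ∑ k, b k * substHom a (pderiv K k f) +
          ∑ k, ∑ l, b k * b l * substHom (Sum.elim a b) (q k l) := by
  classical
  set s : σ → MvPowerSeries (σ ⊕ σ) K := fun i => X (Sum.inl i) + X (Sum.inr i) with hs_def
  set Z : σ ⊕ σ → MvPowerSeries (σ ⊕ σ) K := Sum.elim (fun i => X (Sum.inl i)) 0 with hZ_def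
  have hs : ∀ i, constantCoeff (s i) = 0 := fun i => by simp [s]
  have hsc : ∀ i, s i ∈ convergent v (σ ⊕ σ) := fun i =>
    add_mem (X_mem_convergent _) (X_mem_convergent _)
  have hZ : ∀ i, constantCoeff (Z i) = 0 :=
    constantCoeff_sumElim_eq_zero (fun i => constantCoeff_X _) (fun i => by simp)
  have hZc : ∀ i, Z i ∈ convergent v (σ ⊕ σ) := by
    rintro (i | i)
    · exact X_mem_convergent _
    · exact zero_mem _
  have hinl : ∀ i : σ, constantCoeff (X (Sum.inl i) : MvPowerSeries (σ ⊕ σ) K) = 0 :=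
    fun i => constantCoeff_X _
  -- Hadamard's lemma is used twice: for the series `f(x + y)`, then for each of the resulting
  -- cofactors.
  obtain ⟨G, hGc, hG⟩ := exists_eq_add_sum_X_mul (v := v) (substHom s f)
  choose q hqc hq using fun k => exists_eq_add_sum_X_mul (v := v) (G k)
  have hZs : ∀ g : MvPowerSeries σ K, substHom Z (substHom s g) =
      substHom (fun i => X (Sum.inl i)) g := by
    intro g
    rw [substHom_substHom hs hZ]
    congr 2
    funext i
    simp only [s, map_add, substHom_X hZ]
    simp [Z]
  rw [← hZ_def, hZs] at hG
  -- Differentiating the first expansion with respect to the `k`-th increment and setting the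
  -- increments to zero identifies the linear coefficients. It also yields convergence of the
  -- partial derivatives, since `G k` converges.
  have hder : ∀ k, substHom Z (G k) = substHom (fun i => X (Sum.inl i)) (pderiv K k f) := by
    intro k
    have h1 := congrArg (fun g => substHom Z (pderiv K (Sum.inr k) g)) hG
    simp only [pderiv_substHom hs, pderiv_substHom hinl, map_add, map_sum, map_mul, hZs,
      Derivation.leibniz, smul_eq_mul, substHom_X hZ] at h1
    rw [Finset.sum_eq_single k, Finset.sum_eq_zero, zero_add, Finset.sum_eq_single k] at h1
    · simpa [s, Z] using h1.symm
    · intro j _ hj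
      rw [pderiv_X_of_ne (by simpa using hj)]
      simp [Z]
    · simp
    · intro j _
      rw [pderiv_X_of_ne (by simp)]
      simp
    · intro j _ hj
      simp only [s]
      rw [map_add, pderiv_X_of_ne (by simp), pderiv_X_of_ne (by simpa using hj)]
      simp
    · simp
  refine ⟨q, fun hf k l => hqc k (hGc (substHom_mem_convergent hs hsc hf) k) l, fun hf k => ?_, ?_⟩
  · have h1 : substHom Z (G k) ∈ convergent v (σ ⊕ σ) :=
      substHom_mem_convergent hZ hZc (hGc (substHom_mem_convergent hs hsc hf) k)
    rw [hder] at h1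
    have h0 : ∀ i, constantCoeff ((Sum.elim X 0 : σ ⊕ σ → MvPowerSeries σ K) i) = 0 :=
      constantCoeff_sumElim_eq_zero (fun i => constantCoeff_X _) (fun i => by simp)
    have h2 := substHom_mem_convergent h0 (by
      rintro (i | i)
      · exact X_mem_convergent _
      · exact zero_mem _) h1
    rw [substHom_rename h0] at h2
    simpa [substHom_X_eq] using h2
  · intro β _ a b ha hb
    have hab := constantCoeff_sumElim_eq_zero ha hb
    have h1 : ∀ g, substHom (Sum.elim a b) (substHom s g) = substHom (fun i => a i + b i) g := by
      intro g
      rw [substHom_substHom hs hab]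
      congr 2
      funext i
      simp only [s, map_add, substHom_X hab, Sum.elim_inl, Sum.elim_inr]
    have h2 : ∀ g, substHom (Sum.elim a b) (substHom (fun i => X (Sum.inl i)) g) =
        substHom a g := fun g => substHom_rename hab _ g
    have h3 := congrArg (substHom (Sum.elim a b)) hG
    simp only [h1, map_add, h2, map_sum, map_mul, substHom_X hab, Sum.elim_inr] at h3
    rw [h3, add_assoc]
    congr 1
    rw [← Finset.sum_add_distrib]
    refine Finset.sum_congr rfl fun k _ => ?_
    conv_lhs => rw [hq k, hder]
    simp only [map_add, h2, map_sum, map_mul, substHom_X hab, Sum.elim_inr, mul_add,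
      Finset.mul_sum, mul_assoc]

lemma pderiv_mem_convergent {f : MvPowerSeries σ K} (hf : f ∈ convergent v σ) (k : σ) :
    pderiv K k f ∈ convergent v σ :=
  (exists_taylor v f).choose_spec.2.1 hf k

omit [Fintype τ] in
/-- Substitutions congruent modulo `c` give results congruent modulo `c`. -/
lemma exists_substHom_add_mul_eq (v : AbsoluteValue K ℝ) (f : MvPowerSeries σ K) :
    ∃ q : σ → MvPowerSeries (σ ⊕ σ) K,
      (f ∈ convergent v σ → ∀ k, q k ∈ convergent v (σ ⊕ σ)) ∧
      ∀ {β : Type} [Finite β] (a b : σ → MvPowerSeries β K),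
        (∀ i, constantCoeff (a i) = 0) → (∀ i, constantCoeff (b i) = 0) →
        substHom (fun i => a i + b i) f = substHom a f +
          ∑ k, b k * substHom (Sum.elim a b) (q k) := by
  obtain ⟨q, hq, hd, h⟩ := exists_taylor v f
  refine ⟨fun k => substHom (fun i => X (Sum.inl i)) (pderiv K k f) +
    ∑ l, X (Sum.inr l) * q k l, fun hf k => ?_, ?_⟩
  · exact add_mem (substHom_mem_convergent (fun i => constantCoeff_X _)
      (fun i => X_mem_convergent _) (hd hf k))
      (sum_mem fun l _ => mul_mem (X_mem_convergent _) (hq hf k l))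
  · intro β _ a b ha hb
    have hab := constantCoeff_sumElim_eq_zero ha hb
    rw [h a b ha hb, add_assoc, ← Finset.sum_add_distrib]
    congr 1
    refine Finset.sum_congr rfl fun k _ => ?_
    simp only [map_add, map_sum, map_mul, substHom_X hab, substHom_rename hab, Sum.elim_inl,
      Sum.elim_inr, mul_add, Finset.mul_sum, mul_assoc]

end Taylor

end MvPowerSeries

/-! ### The implicit function theorem. -/

namespace MvPowerSeries

variable {K : Type*} [Field K] {σ ι β : Type}

/-- The weight giving the base variables weight `2` and the unknowns weight `1`. -/
def implicitWeight : σ ⊕ ι → ℕ := Sum.elim (fun _ => 2) fun _ => 1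

lemma constantCoeff_eq_zero_iff_one_le_order {f : MvPowerSeries σ K} :
    constantCoeff f = 0 ↔ 1 ≤ f.order := by
  rw [Order.one_le_iff_ne_zero, order_ne_zero_iff_constCoeff_eq_zero]

section Contracting

variable {Φ : MvPowerSeries (σ ⊕ ι) K}

lemma constantCoeff_pderiv_of_implicitWeight (hΦ : 2 ≤ Φ.weightedOrder implicitWeight) (i : ι) :
    constantCoeff (pderiv K (Sum.inr i) Φ) = 0 := by
  rw [← coeff_zero_eq_constantCoeff_apply, coeff_pderiv, zero_add,
    coeff_eq_zero_of_lt_weightedOrder implicitWeight, zero_mul]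
  refine lt_of_lt_of_le ?_ hΦ
  rw [Finsupp.weight_single]
  simp [implicitWeight]

lemma constantCoeff_of_implicitWeight (hΦ : 2 ≤ Φ.weightedOrder implicitWeight) :
    constantCoeff Φ = 0 := by
  rw [← coeff_zero_eq_constantCoeff_apply, coeff_eq_zero_of_lt_weightedOrder implicitWeight]
  refine lt_of_lt_of_le ?_ hΦ
  simp

/-- With base variables of weight `2`, weighted order at least `2` means that `Φ` has neither a
constant term nor a linear term in the unknowns. In the Taylor expansion of the difference, each `z
i - z' i` is therefore multiplied by a series without constant term: a partial derivative in the
linear part, another difference in the quadratic part. The order rises by one. -/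
lemma substHom_implicit_contracting [Fintype σ] [Fintype ι] [Finite β]
    (hΦ : 2 ≤ Φ.weightedOrder implicitWeight)
    {a : σ → MvPowerSeries β K} (ha : ∀ i, constantCoeff (a i) = 0)
    {z z' : ι → MvPowerSeries β K} (hz : ∀ i, constantCoeff (z i) = 0)
    (hz' : ∀ i, constantCoeff (z' i) = 0) {k : ℕ} (h : ∀ i, (k : ℕ∞) ≤ (z i - z' i).order) :
    ((k + 1 : ℕ) : ℕ∞) ≤
      (substHom (Sum.elim a z) Φ - substHom (Sum.elim a z') Φ).order := by
  classical
  -- Only the formal identity is used, so the choice of absolute value is immaterial.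
  obtain ⟨q, -, -, hq⟩ := exists_taylor (AbsoluteValue.trivial : AbsoluteValue K ℝ) Φ
  set b : σ ⊕ ι → MvPowerSeries β K := Sum.elim 0 fun i => z i - z' i with hb_def
  have hb0 : ∀ i, constantCoeff (b i) = 0 :=
    constantCoeff_sumElim_eq_zero (fun _ => by simp) (fun i => by rw [map_sub, hz, hz', sub_zero])
  have hbk : ∀ i, (k : ℕ∞) ≤ (b i).order := by
    rintro (i | i)
    · simp [b]
    · exact h i
  have haz' := constantCoeff_sumElim_eq_zero ha hz'
  have hab : (fun i => Sum.elim a z' i + b i) = Sum.elim a z := by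
    funext i
    rcases i with i | i <;> simp [b]
  have h1 := hq (Sum.elim a z') b haz' hb0
  rw [hab] at h1
  rw [h1, add_assoc, add_sub_cancel_left]
  have hmul : ∀ f g : MvPowerSeries β K, (k : ℕ∞) ≤ f.order → 1 ≤ g.order →
      ((k + 1 : ℕ) : ℕ∞) ≤ (f * g).order := fun f g hf hg => by
    refine le_trans ?_ le_order_mul
    rw [Nat.cast_add, Nat.cast_one]
    exact add_le_add hf hg
  refine le_weightedOrder_add (w := fun _ => 1) (le_weightedOrder_sum fun i _ => ?_)
    (le_weightedOrder_sum fun i _ => le_weightedOrder_sum fun j _ => ?_)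
  · rcases i with i | i
    · simp [b]
    · refine hmul _ _ (hbk _) (constantCoeff_eq_zero_iff_one_le_order.1 ?_)
      rw [constantCoeff_substHom]
      exact constantCoeff_pderiv_of_implicitWeight hΦ i
  · rw [mul_assoc]
    refine hmul _ _ (hbk _) (constantCoeff_eq_zero_iff_one_le_order.1 ?_)
    rw [map_mul, hb0, zero_mul]

end Contracting

section Implicit

variable [Fintype σ] [Fintype ι] {Φ : ι → MvPowerSeries (σ ⊕ ι) K} {v : AbsoluteValue K ℝ}

/-- Uniqueness in the implicit function theorem. -/
theorem implicit_unique [Finite β] (hΦ : ∀ i, 2 ≤ (Φ i).weightedOrder implicitWeight)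
    {a : σ → MvPowerSeries β K} (ha : ∀ i, constantCoeff (a i) = 0)
    {z z' : ι → MvPowerSeries β K} (hz : ∀ i, constantCoeff (z i) = 0)
    (hz' : ∀ i, constantCoeff (z' i) = 0) (h : ∀ i, substHom (Sum.elim a z) (Φ i) = z i)
    (h' : ∀ i, substHom (Sum.elim a z') (Φ i) = z' i) : z = z' :=
  fixedPoint_unique_of_contracting (fun _ => 1) {z | ∀ i, constantCoeff (z i) = 0}
    (fun z i => substHom (Sum.elim a z) (Φ i))
    (fun _ hz _ hz' _ h i => substHom_implicit_contracting (hΦ i) ha hz hz' h)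
    hz hz' (funext h) (funext h')

/-- The implicit function theorem for convergent power series, in fixed point form. -/
theorem exists_implicit (hΦ : ∀ i, 2 ≤ (Φ i).weightedOrder implicitWeight)
    (hΦc : ∀ i, Φ i ∈ convergent v (σ ⊕ ι)) :
    ∃ z : ι → MvPowerSeries σ K, (∀ i, z i ∈ convergent v σ) ∧ (∀ i, constantCoeff (z i) = 0) ∧
      ∀ i, substHom (Sum.elim X z) (Φ i) = z i := by
  obtain ⟨r, hr, hr', hrΦ⟩ := exists_common_radius hΦc
  choose c hc hc1 hcr using fun i => exists_pos_mul_le (hrΦ i) (hr (Sum.inr i))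
  obtain ⟨ε, hε, hε1, hεc⟩ := exists_pos_le_of_finite hc
  have hεr : ∀ i, ε * l1norm v r (Φ i) ≤ r (Sum.inr i) := fun i =>
    (mul_le_mul_left (hεc i) _).trans (hcr i)
  -- The base radii are scaled by `ε ^ 2` and the ball for the unknowns by `ε`, matching the
  -- weights. Then `Φ` is bounded by `ε ^ 2` times its norm, hence by `ε` times the radius of the
  -- unknown, and the ball is stable.
  set s : σ → ℝ≥0∞ := fun i => ε ^ 2 * r (Sum.inl i)
  have hX : ∀ i : σ, constantCoeff (X i : MvPowerSeries σ K) = 0 := fun i => constantCoeff_X i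
  obtain ⟨z, ⟨hz0, hzB⟩, hz⟩ := exists_fixedPoint_of_contracting (fun _ => 1)
    {z : ι → MvPowerSeries σ K | (∀ i, constantCoeff (z i) = 0) ∧
      ∀ i, l1norm v s (z i) ≤ ε * r (Sum.inr i)}
    (fun z i => substHom (Sum.elim X z) (Φ i))
    ⟨0, fun i => by simp, fun i => by simp [l1norm_zero]⟩
    (fun z hz => by
      refine ⟨fun i => ?_, fun i => ?_⟩
      · rw [constantCoeff_substHom]
        exact constantCoeff_of_implicitWeight (hΦ i)
      · have h0 := constantCoeff_sumElim_eq_zero hX hz.1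
        change l1norm v s (substHom (Sum.elim X z) (Φ i)) ≤ _
        rw [substHom_eq h0]
        calc _ ≤ l1norm v (fun j => l1norm v s (Sum.elim X z j)) (Φ i) :=
              l1norm_subst_le _ (hasSubst_of_constantCoeff_zero h0) _
          _ ≤ l1norm v (fun j => ε ^ implicitWeight j * r j) (Φ i) := by
              refine l1norm_mono (fun j => ?_) _
              rcases j with j | j
              · simp [l1norm_X, s, implicitWeight]
              · simpa [implicitWeight] using hz.2 j
          _ ≤ ε ^ 2 * l1norm v r (Φ i) :=
              l1norm_scale_le r hε1 implicitWeight (k := 2) (by exact_mod_cast hΦ i)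
          _ = ε * (ε * l1norm v r (Φ i)) := by rw [pow_two, mul_assoc]
          _ ≤ _ := mul_le_mul_right (hεr i) _)
    (fun z hz => by
      refine ⟨fun i => ?_, fun i => ?_⟩
      · obtain ⟨z', hz', h⟩ := hz 1
        rw [← coeff_zero_eq_constantCoeff_apply,
          coeff_eq_of_le_weightedOrder_sub (h i) (by simp), coeff_zero_eq_constantCoeff_apply,
          hz'.1 i]
      · refine l1norm_le_of_approx (fun _ => 1) s _ _ fun k => ?_
        obtain ⟨z', hz', h⟩ := hz k
        exact ⟨z' i, hz'.2 i, h i⟩)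
    (fun z hz z' hz' k h i => substHom_implicit_contracting (hΦ i) hX hz.1 hz'.1 h)
  refine ⟨z, fun i => ⟨s, fun i => ?_, lt_of_le_of_lt (hzB i) ?_⟩, hz0, fun i => congrFun hz i⟩
  · exact ENNReal.mul_pos (pow_ne_zero _ hε.ne') (hr _).ne'
  · exact ENNReal.mul_lt_top (hε1.trans_lt ENNReal.one_lt_top) (hr' _)

end Implicit

end MvPowerSeries

/-! ### Convergent families and propagation of relations. -/

namespace MvPowerSeries

variable {K : Type*} [Field K] {σ τ : Type}

section Families

variable [Fintype σ] [Fintype τ]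

/-- The formal solution `ybar` is a specialization of a convergent family of common zeros
of the series in `F`. -/
def HasConvergentFamily (v : AbsoluteValue K ℝ) (F : Set (MvPowerSeries (σ ⊕ τ) K))
    (ybar : τ → MvPowerSeries σ K) : Prop :=
  ∃ (T : Type) (_ : Fintype T) (y : τ → MvPowerSeries (σ ⊕ T) K) (tbar : T → MvPowerSeries σ K),
    (∀ k, y k ∈ convergent v (σ ⊕ T)) ∧ (∀ k, constantCoeff (y k) = 0) ∧
    (∀ t, constantCoeff (tbar t) = 0) ∧ (∀ k, substHom (Sum.elim X tbar) (y k) = ybar k) ∧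
    ∀ f ∈ F, substHom (Sum.elim (fun i => X (Sum.inl i)) y) f = 0

/-- The convergent relations satisfied by the formal series `ybar`. -/
def convergentRelations (v : AbsoluteValue K ℝ) (ybar : τ → MvPowerSeries σ K) :
    Set (MvPowerSeries (σ ⊕ τ) K) :=
  {g | g ∈ convergent v (σ ⊕ τ) ∧ substHom (Sum.elim X ybar) g = 0}

end Families

lemma constantCoeff_X_inl (i : σ) : constantCoeff (X (Sum.inl i) : MvPowerSeries (σ ⊕ τ) K) = 0 :=
  constantCoeff_X _

section Option

lemma X_none_dvd_of_substHom [Fintype σ] {F : MvPowerSeries (Option σ) K}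
    (h : substHom (fun o => o.elim 0 fun i => X (some i) : Option σ → MvPowerSeries (Option σ) K) F
      = 0) : X none ∣ F := by
  classical
  obtain ⟨q, -, hq⟩ := exists_substHom_add_mul_eq (AbsoluteValue.trivial : AbsoluteValue K ℝ) F
  set a : Option σ → MvPowerSeries (Option σ) K := fun o => o.elim 0 fun i => X (some i)
  set b : Option σ → MvPowerSeries (Option σ) K := fun o => o.elim (X none) fun _ => 0
  have hab : (fun i => a i + b i) = X := by
    funext o
    cases o <;> simp [a, b]
  have h1 := hq a b (by rintro (_ | i) <;> simp [a]) (by rintro (_ | i) <;> simp [b])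
  rw [hab, substHom_X_eq, h, zero_add] at h1
  rw [h1]
  refine Finset.dvd_sum fun o _ => Dvd.dvd.mul_right ?_ _
  cases o <;> simp [b]

instance : IsDomain (MvPowerSeries σ K) := NoZeroDivisors.to_isDomain _

lemma X_none_prime : Prime (X none : MvPowerSeries (Option σ) K) := by
  rw [← MulEquiv.prime_iff (optionEquivLeft σ K), optionEquivLeft_X_none]
  exact PowerSeries.X_prime

/-- Characteristic zero enters here: a coefficient of the derivative is a coefficient of `F` times a
positive exponent of the distinguished variable, and that factor can be cancelled. -/
lemma X_none_pow_succ_dvd_of_pderiv [CharZero K] {F : MvPowerSeries (Option σ) K} {n : ℕ}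
    (h0 : X none ∣ F) (h : X none ^ n ∣ pderiv K none F) : X none ^ (n + 1) ∣ F := by
  classical
  rw [X_pow_dvd_iff] at h ⊢
  intro m hm
  by_cases hm0 : m none = 0
  · exact X_dvd_iff.1 h0 m hm0
  · have hle : Finsupp.single none 1 ≤ m :=
      Finsupp.single_le_iff.2 (Nat.one_le_iff_ne_zero.2 hm0)
    have h1 := h (m - Finsupp.single none 1) (by simp; omega)
    rw [coeff_pderiv, tsub_add_cancel_of_le hle] at h1
    exact (mul_eq_zero.1 h1).resolve_right (Nat.cast_add_one_ne_zero _)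

/-- Scaling a group of variables by a new variable is injective. -/
lemma substHom_scale_injective [Fintype σ] (w : σ → ℕ) :
    Function.Injective (substHom (fun j => X none ^ w j * X (some j) :
      σ → MvPowerSeries (Option σ) K)) := by
  classical
  set a : σ → MvPowerSeries (Option σ) K := fun j => X none ^ w j * X (some j)
  have ha : ∀ i, constantCoeff (a i) = 0 := fun i => by simp [a]
  -- The substitution sends the monomial `d` to the single monomial `E d`, from which `d` can be
  -- read off, so no cancellation occurs.
  let E : (σ →₀ ℕ) → (Option σ →₀ ℕ) := fun d => d.optionElim (Finsupp.weight w d)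
  have hE : Function.Injective E := fun d e h => by
    simpa [E] using congrArg Finsupp.some h
  have hprod : ∀ d : σ →₀ ℕ, (d.prod fun s k => a s ^ k) = monomial (E d) 1 := by
    intro d
    induction d using Finsupp.induction_linear with
    | zero => simp [E]
    | add d e hd he =>
      rw [Finsupp.prod_add_index' (by simp) (fun _ _ _ => pow_add _ _ _), hd, he,
        monomial_mul_monomial, one_mul]
      simp only [E, map_add, Finsupp.optionElim_add]
    | single j k =>
      rw [Finsupp.prod_single_index (by simp)]
      simp only [a, mul_pow, ← pow_mul]
      rw [X_pow_eq, X_pow_eq, monomial_mul_monomial, one_mul]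
      refine congrArg (fun e => monomial e (1 : K)) (Finsupp.ext fun o => ?_)
      cases o with
      | none => simp [E, Finsupp.weight_single, mul_comm]
      | some i => simp [E, Finsupp.single_apply]
  intro f g hfg
  ext d
  have key : ∀ f, coeff (E d) (substHom a f) = coeff d f := by
    intro f
    rw [substHom_eq ha, coeff_subst (hasSubst_of_constantCoeff_zero ha), finsum_eq_single _ d]
    · rw [hprod, coeff_monomial_same, smul_eq_mul, mul_one]
    · intro e he
      rw [hprod, coeff_monomial_ne (fun h => he (hE h).symm), smul_zero]
  rw [← key, ← key, hfg]

end Option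

section Propagation

variable [Fintype σ] [Fintype τ] {T : Type} [Fintype T]

/-- The translation of the parameters by a multiple of new parameters is injective. -/
lemma substHom_translate_injective {tbar : T → MvPowerSeries σ K}
    (ht : ∀ t, constantCoeff (tbar t) = 0) :
    Function.Injective (substHom (Sum.elim (fun i => X (some (Sum.inl i)))
      (fun t => substHom (fun i => X (some (Sum.inl i))) (tbar t) +
        X none * X (some (Sum.inr t))) : σ ⊕ T → MvPowerSeries (Option (σ ⊕ T)) K)) := by
  -- The map factors as the translation `L`, invertible with inverse `L'`, followed by the scaling
  -- `S` of the parameters by the new variable.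
  set L : σ ⊕ T → MvPowerSeries (σ ⊕ T) K := Sum.elim (fun i => X (Sum.inl i))
    (fun t => substHom (fun i => X (Sum.inl i)) (tbar t) + X (Sum.inr t))
  set L' : σ ⊕ T → MvPowerSeries (σ ⊕ T) K := Sum.elim (fun i => X (Sum.inl i))
    (fun t => X (Sum.inr t) - substHom (fun i => X (Sum.inl i)) (tbar t))
  set S : σ ⊕ T → MvPowerSeries (Option (σ ⊕ T)) K :=
    fun j => X none ^ (Sum.elim (fun _ => 0) (fun _ => 1) j : ℕ) * X (some j)
  have hL : ∀ i, constantCoeff (L i) = 0 :=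
    constantCoeff_sumElim_eq_zero constantCoeff_X_inl (fun t => by simp [ht])
  have hL' : ∀ i, constantCoeff (L' i) = 0 :=
    constantCoeff_sumElim_eq_zero constantCoeff_X_inl (fun t => by simp [ht])
  have hS : ∀ i, constantCoeff (S i) = 0 := fun i => by simp [S]
  have hinj : Function.Injective (substHom L) := by
    refine Function.LeftInverse.injective (g := substHom L') fun f => ?_
    rw [substHom_substHom hL hL']
    conv_rhs => rw [← substHom_X_eq f]
    congr 2
    funext j
    rcases j with i | t
    · simp only [L, Sum.elim_inl, substHom_X hL', L']
    · simp only [L, Sum.elim_inr, map_add, substHom_X hL', substHom_rename hL']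
      simp [L']
  have hcomp := (substHom_scale_injective (K := K)
    (Sum.elim (fun _ => 0) (fun _ => 1) : σ ⊕ T → ℕ)).comp hinj
  convert hcomp using 1
  funext f
  simp only [Function.comp_apply]
  rw [substHom_substHom hL hS]
  congr 2
  funext j
  rcases j with i | t
  · simp [L, substHom_X hS]
    simp [S]
  · simp only [L, Sum.elim_inr, map_add, substHom_X hS, substHom_rename hS]
    simp [S]

variable {v : AbsoluteValue K ℝ} {ι : Type} [Fintype ι]

/-- A convergent family through a formal solution on which enough relations vanish satisfies all
convergent relations of the formal solution. -/
theorem relations_vanish_of_jacobian [CharZero K] {ybar : τ → MvPowerSeries σ K}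
    (f : ι → MvPowerSeries (σ ⊕ τ) K) (δ : MvPowerSeries (σ ⊕ τ) K)
    (hδ : substHom (Sum.elim X ybar) δ ≠ 0)
    (hD : ∀ g ∈ convergentRelations v ybar, ∃ h : ι → MvPowerSeries (σ ⊕ τ) K, ∀ k : τ,
      δ * pderiv K (Sum.inr k) g - ∑ i, h i * pderiv K (Sum.inr k) (f i) ∈
        convergentRelations v ybar)
    {y : τ → MvPowerSeries (σ ⊕ T) K} {tbar : T → MvPowerSeries σ K}
    (hy0 : ∀ k, constantCoeff (y k) = 0) (ht : ∀ t, constantCoeff (tbar t) = 0)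
    (hyt : ∀ k, substHom (Sum.elim X tbar) (y k) = ybar k)
    (hf : ∀ i, substHom (Sum.elim (fun i => X (Sum.inl i)) y) (f i) = 0)
    {g : MvPowerSeries (σ ⊕ τ) K} (hg : g ∈ convergentRelations v ybar) :
    substHom (Sum.elim (fun i => X (Sum.inl i)) y) g = 0 := by
  -- The parameters move along the line `tbar + X none * t`. At `X none = 0` the family becomes the
  -- formal solution, and since `Θ` is injective it suffices to show that `g` vanishes after this
  -- substitution.
  set Θ : σ ⊕ T → MvPowerSeries (Option (σ ⊕ T)) K := Sum.elim (fun i => X (some (Sum.inl i)))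
    (fun t => substHom (fun i => X (some (Sum.inl i))) (tbar t) + X none * X (some (Sum.inr t)))
    with hΘ_def
  have hΘ : ∀ i, constantCoeff (Θ i) = 0 :=
    constantCoeff_sumElim_eq_zero (fun i => constantCoeff_X _) (fun t => by simp [ht])
  set a : σ ⊕ τ → MvPowerSeries (Option (σ ⊕ T)) K :=
    Sum.elim (fun i => X (some (Sum.inl i))) (fun k => substHom Θ (y k)) with ha_def
  have ha : ∀ i, constantCoeff (a i) = 0 :=
    constantCoeff_sumElim_eq_zero (fun i => constantCoeff_X _) (fun k => by simp [hy0])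
  have hy := constantCoeff_sumElim_eq_zero (constantCoeff_X_inl (K := K) (σ := σ) (τ := T)) hy0
  have hXt := constantCoeff_sumElim_eq_zero (fun i : σ => constantCoeff_X (R := K) i) ht
  have hΘψ : ∀ g, substHom Θ (substHom (Sum.elim (fun i => X (Sum.inl i)) y) g) =
      substHom a g := by
    intro g
    rw [substHom_substHom hy hΘ]
    congr 2
    funext j
    rcases j with i | k
    · simp only [Sum.elim_inl, substHom_X hΘ, a, Θ]
    · simp only [Sum.elim_inr, a]
  -- setting the new variable to zero recovers the formal solution
  have hspec : ∀ {β : Type} [Finite β] (c : σ → MvPowerSeries β K)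
      (Z : Option (σ ⊕ T) → MvPowerSeries β K), (∀ i, constantCoeff (c i) = 0) →
      (∀ i, constantCoeff (Z i) = 0) → Z none = 0 → (∀ i, Z (some (Sum.inl i)) = c i) →
      ∀ g, substHom Z (substHom a g) = substHom c (substHom (Sum.elim X ybar) g) := by
    intro β _ c Z hc hZ hZn hZs g
    have hZΘ : ∀ g, substHom Z (substHom Θ g) = substHom c (substHom (Sum.elim X tbar) g) := by
      intro g
      rw [substHom_substHom hΘ hZ, substHom_substHom hXt hc]
      congr 2
      funext j
      rcases j with i | t
      · simp only [Θ, Sum.elim_inl, substHom_X hZ, substHom_X hc, hZs]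
      · simp only [Θ, Sum.elim_inr, map_add, map_mul, substHom_X hZ, hZn, zero_mul, add_zero,
          substHom_rename hZ, hZs]
    have hybar : ∀ k, constantCoeff (ybar k) = 0 := fun k => by
      rw [← hyt, constantCoeff_substHom, hy0]
    rw [substHom_substHom ha hZ, substHom_substHom
      (constantCoeff_sumElim_eq_zero (fun i => constantCoeff_X _) hybar) hc]
    congr 2
    funext j
    rcases j with i | k
    · simp only [a, Sum.elim_inl, substHom_X hZ, substHom_X hc, hZs]
    · simp only [a, Sum.elim_inr, hZΘ, hyt]
  have hdvd : ∀ g ∈ convergentRelations v ybar, X none ∣ substHom a g := by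
    intro g hg
    apply X_none_dvd_of_substHom
    rw [hspec (fun i => X (some (Sum.inl i))) (fun o => o.elim 0 fun i => X (some i)) (fun i => constantCoeff_X _)
      (by rintro (_ | i) <;> simp) rfl (fun i => rfl), hg.2, map_zero]
  have hndvd : ¬ X none ∣ substHom a δ := by
    rintro ⟨q, hq⟩
    have hZ : ∀ o : Option (σ ⊕ T), constantCoeff
        (o.elim 0 (Sum.elim X fun _ => 0) : MvPowerSeries σ K) = 0 := by
      rintro (_ | i | i) <;> simp
    have h1 := hspec X (fun o => o.elim 0 (Sum.elim X fun _ => 0)) (fun i => constantCoeff_X _) hZ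
      rfl (fun i => rfl) δ
    rw [hq, map_mul, substHom_X hZ, substHom_X_eq] at h1
    exact hδ (by rw [← h1]; simp)
  have hder : ∀ g, pderiv K none (substHom a g) =
      ∑ k, substHom a (pderiv K (Sum.inr k) g) * pderiv K none (a (Sum.inr k)) := by
    intro g
    rw [pderiv_substHom ha, Fintype.sum_sum_type, Finset.sum_eq_zero, zero_add]
    intro i _
    rw [ha_def, Sum.elim_inl, pderiv_X_of_ne (by simp), mul_zero]
  have hfa : ∀ i, substHom a (f i) = 0 := fun i => by rw [← hΘψ, hf, map_zero]
  -- The induction treats all relations simultaneously. The terms in `f` drop out because `f`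
  -- vanishes identically on the family, so `δ` times the derivative of `g` along the line is a
  -- combination of relations, divisible by `X none ^ n`. The prime `X none` does not divide `δ`, so
  -- the derivative itself is divisible, and integrating gains one more power.
  have hpow : ∀ n : ℕ, ∀ g ∈ convergentRelations v ybar, X none ^ n ∣ substHom a g := by
    intro n
    induction n with
    | zero => simp
    | succ n ih =>
      intro g hg
      refine X_none_pow_succ_dvd_of_pderiv (hdvd g hg) ?_
      refine X_none_prime.pow_dvd_of_dvd_mul_left n hndvd ?_
      obtain ⟨h, hh⟩ := hD g hg
      have h1 : substHom a δ * pderiv K none (substHom a g) =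
          ∑ k, substHom a (δ * pderiv K (Sum.inr k) g -
            ∑ i, h i * pderiv K (Sum.inr k) (f i)) * pderiv K none (a (Sum.inr k)) := by
        have h2 : ∑ k, substHom a (∑ i, h i * pderiv K (Sum.inr k) (f i)) *
            pderiv K none (a (Sum.inr k)) = 0 := by
          simp only [map_sum, map_mul, Finset.sum_mul]
          rw [Finset.sum_comm]
          refine Finset.sum_eq_zero fun i _ => ?_
          simp only [mul_assoc]
          rw [← Finset.mul_sum, ← hder, hfa, map_zero, mul_zero]
        simp only [map_sub, sub_mul, Finset.sum_sub_distrib, h2, sub_zero, map_mul]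
        rw [hder, Finset.mul_sum]
        exact Finset.sum_congr rfl fun k _ => (mul_assoc _ _ _).symm
      rw [h1]
      exact Finset.dvd_sum fun k _ => (ih _ (hh k)).mul_right _
  have hzero : substHom a g = 0 := by
    ext m
    exact X_pow_dvd_iff.1 (hpow (m none + 1) g hg) m (Nat.lt_succ_self _)
  apply substHom_translate_injective ht
  rw [map_zero, ← hΘ_def, hΘψ, hzero]

end Propagation

end MvPowerSeries

/-! ### Jacobian minors of maximal size. -/

namespace Matrix

/-- The bordered determinant in terms of the adjugate of the leading block. -/
lemma det_mul_det_fromBlocks_unit {R n : Type*} [CommRing R] [Fintype n] [DecidableEq n]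
    (A : Matrix n n R) (B : Matrix n Unit R) (C : Matrix Unit n R) (D : Matrix Unit Unit R) :
    A.det * (fromBlocks A B C D).det =
      A.det * (A.det * D () () - (C * A.adjugate * B) () ()) := by
  have h : fromBlocks 1 0 (-(C * A.adjugate)) (A.det • (1 : Matrix Unit Unit R)) *
      fromBlocks A B C D = fromBlocks A B 0 (A.det • D - C * A.adjugate * B) := by
    rw [fromBlocks_multiply]
    congr 1
    · simp
    · simp
    · rw [Matrix.neg_mul, Matrix.mul_assoc, adjugate_mul]
      simp
    · rw [Matrix.neg_mul, Matrix.smul_mul, Matrix.one_mul]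
      abel
  have h' := congrArg det h
  rw [det_mul, det_fromBlocks_zero₁₂, det_fromBlocks_zero₂₁] at h'
  simpa [det_unique] using h'

end Matrix

namespace MvPowerSeries

variable {K : Type*} [Field K] {σ τ : Type}

lemma det_mem_subalgebra {R A n : Type*} [CommRing R] [CommRing A] [Algebra R A] [Fintype n]
    [DecidableEq n] (S : Subalgebra R A) {M : Matrix n n A} (hM : ∀ i j, M i j ∈ S) :
    M.det ∈ S := by
  rw [Matrix.det_apply']
  exact sum_mem fun p _ => mul_mem (intCast_mem _ _) (prod_mem fun i _ => hM _ _)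

lemma adjugate_mem_subalgebra {R A n : Type*} [CommRing R] [CommRing A] [Algebra R A] [Fintype n]
    [DecidableEq n] (S : Subalgebra R A) {M : Matrix n n A} (hM : ∀ i j, M i j ∈ S) (i j : n) :
    M.adjugate i j ∈ S := by
  rw [Matrix.adjugate_apply]
  refine det_mem_subalgebra S fun k l => ?_
  rw [Matrix.updateRow_apply]
  split_ifs
  · rw [Pi.single_apply]
    split_ifs
    · exact one_mem _
    · exact zero_mem _
  · exact hM _ _

variable [Fintype σ] [Fintype τ] {v : AbsoluteValue K ℝ}

/-- The minor of the Jacobian matrix of `f` with respect to the second group of variables in the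
columns `κ`. -/
noncomputable def jacobianMinor {n : Type} (f : n → MvPowerSeries (σ ⊕ τ) K) (κ : n → τ) :
    Matrix n n (MvPowerSeries (σ ⊕ τ) K) :=
  Matrix.of fun i j => pderiv K (Sum.inr (κ j)) (f i)

/-- A system of convergent relations whose Jacobian matrix has maximal rank along a formal
solution. -/
theorem exists_maximal_jacobianMinor (ybar : τ → MvPowerSeries σ K) :
    ∃ (h : ℕ) (f : Fin h → MvPowerSeries (σ ⊕ τ) K) (κ : Fin h → τ),
      (∀ i, f i ∈ convergentRelations v ybar) ∧
      substHom (Sum.elim X ybar) (jacobianMinor f κ).det ≠ 0 ∧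
      ∀ g ∈ convergentRelations v ybar, ∃ c : Fin h → MvPowerSeries (σ ⊕ τ) K, ∀ k : τ,
        (jacobianMinor f κ).det * pderiv K (Sum.inr k) g -
          ∑ i, c i * pderiv K (Sum.inr k) (f i) ∈ convergentRelations v ybar := by
  classical
  set φ := substHom (Sum.elim X ybar : σ ⊕ τ → MvPowerSeries σ K)
  let P : ℕ → Prop := fun h => ∃ (f : Fin h → MvPowerSeries (σ ⊕ τ) K) (κ : Fin h → τ),
    (∀ i, f i ∈ convergentRelations v ybar) ∧ φ (jacobianMinor f κ).det ≠ 0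
  have hP0 : P 0 := ⟨Fin.elim0, Fin.elim0, fun i => i.elim0, by simp⟩
  -- With more columns than unknowns some column is repeated, so the minor is zero.
  have hPN : ¬ P (Fintype.card τ + 1) := by
    rintro ⟨f, κ, -, hdet⟩
    obtain ⟨i, j, hij, hκ⟩ := Fintype.exists_ne_map_eq_of_card_lt κ (by simp)
    refine hdet ?_
    rw [Matrix.det_zero_of_column_eq hij fun k => ?_, map_zero]
    simp [jacobianMinor, hκ]
  obtain ⟨h, ⟨f, κ, hf, hdet⟩, hmax⟩ : ∃ h, P h ∧ ¬ P (h + 1) := by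
    by_contra hc
    push Not at hc
    exact hPN (Nat.rec hP0 hc (Fintype.card τ + 1))
  have hJ : ∀ i j, jacobianMinor f κ i j ∈ convergent v (σ ⊕ τ) := fun i j =>
    pderiv_mem_convergent (hf i).1 _
  refine ⟨h, f, κ, hf, hdet, fun g hg => ?_⟩
  refine ⟨fun i => ∑ j, pderiv K (Sum.inr (κ j)) g * (jacobianMinor f κ).adjugate j i,
    fun k => ⟨?_, ?_⟩⟩
  · refine sub_mem (mul_mem (det_mem_subalgebra _ hJ) (pderiv_mem_convergent hg.1 _))
      (sum_mem fun i _ => mul_mem (sum_mem fun j _ => mul_mem (pderiv_mem_convergent hg.1 _)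
        (adjugate_mem_subalgebra _ hJ _ _)) (pderiv_mem_convergent (hf i).1 _))
  · let f' : Fin h ⊕ Unit → MvPowerSeries (σ ⊕ τ) K := Sum.elim f fun _ => g
    let κ' : Fin h ⊕ Unit → τ := Sum.elim κ fun _ => k
    -- By maximality, bordering the minor with the row of `g` and the column `k` gives a determinant
    -- vanishing along `ybar`. Expanding it by the adjugate and cancelling the nonzero minor gives
    -- the required relation.
    have hzero : φ (jacobianMinor f' κ').det = 0 := by
      by_contra hne
      let e : Fin (h + 1) ≃ Fin h ⊕ Unit := Fintype.equivOfCardEq (by simp)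
      refine hmax ⟨f' ∘ e, κ' ∘ e, fun i => ?_, ?_⟩
      · change f' (e i) ∈ _
        rcases e i with j | j
        · exact hf j
        · exact hg
      · have : jacobianMinor (f' ∘ e) (κ' ∘ e) = (jacobianMinor f' κ').submatrix e e := rfl
        rw [this, Matrix.det_submatrix_equiv_self]
        exact hne
    have hblock : jacobianMinor f' κ' = Matrix.fromBlocks (jacobianMinor f κ)
        (Matrix.of fun i _ => pderiv K (Sum.inr k) (f i))
        (Matrix.of fun _ j => pderiv K (Sum.inr (κ j)) g)
        (Matrix.of fun _ _ => pderiv K (Sum.inr k) g) := by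
      ext1 i j
      rcases i with i | i <;> rcases j with j | j <;> rfl
    have h1 := congrArg φ (Matrix.det_mul_det_fromBlocks_unit (jacobianMinor f κ)
        (Matrix.of fun i _ => pderiv K (Sum.inr k) (f i))
        (Matrix.of fun _ j => pderiv K (Sum.inr (κ j)) g)
        (Matrix.of fun _ _ => pderiv K (Sum.inr k) g))
    rw [← hblock, map_mul, hzero, mul_zero, map_mul] at h1
    have h2 := (mul_eq_zero.1 h1.symm).resolve_left hdet
    convert h2 using 3
    · rfl
    · simp [Matrix.mul_apply]

/-- To solve all convergent relations it suffices to solve systems with a nonvanishing Jacobian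
minor, presented by a right multiplier of the Jacobian matrix. -/
theorem hasConvergentFamily_relations_of_nondegenerate [CharZero K]
    {ybar : τ → MvPowerSeries σ K}
    (H : ∀ (ι : Type) [Fintype ι] [DecidableEq ι] (f : ι → MvPowerSeries (σ ⊕ τ) K)
      (M : Matrix τ ι (MvPowerSeries (σ ⊕ τ) K)) (δ : MvPowerSeries (σ ⊕ τ) K),
      (∀ i, f i ∈ convergentRelations v ybar) → (∀ k j, M k j ∈ convergent v (σ ⊕ τ)) →
      δ ∈ convergent v (σ ⊕ τ) →
      (∀ i j, ∑ k, pderiv K (Sum.inr k) (f i) * M k j = if i = j then δ else 0) →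
      substHom (Sum.elim X ybar) δ ≠ 0 → HasConvergentFamily v (Set.range f) ybar) :
    HasConvergentFamily v (convergentRelations v ybar) ybar := by
  classical
  obtain ⟨h, f, κ, hf, hdet, hD⟩ := exists_maximal_jacobianMinor (v := v) ybar
  have hJ : ∀ i j, jacobianMinor f κ i j ∈ convergent v (σ ⊕ τ) := fun i j =>
    pderiv_mem_convergent (hf i).1 _
  obtain ⟨T, hT, y, tbar, hyc, hy0, ht0, hyt, hyf⟩ := H (Fin h) f
    -- The adjugate of the minor, placed in the rows selected by `κ`, is a right multiplier turning
    -- the whole Jacobian matrix into the determinant times the identity.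
    (Matrix.of fun k j => ∑ l, if κ l = k then (jacobianMinor f κ).adjugate l j else 0)
    (jacobianMinor f κ).det hf
    (fun k j => sum_mem fun l _ => by
      split_ifs
      · exact adjugate_mem_subalgebra _ hJ _ _
      · exact zero_mem _)
    (det_mem_subalgebra _ hJ)
    (fun i j => by
      have h1 := congrFun (congrFun (Matrix.mul_adjugate (jacobianMinor f κ)) i) j
      rw [Matrix.smul_apply, Matrix.one_apply, smul_eq_mul, mul_ite, mul_one, mul_zero] at h1
      rw [← h1, Matrix.mul_apply]
      simp only [Matrix.of_apply, Finset.mul_sum, mul_ite, mul_zero]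
      rw [Finset.sum_comm]
      refine Finset.sum_congr rfl fun l _ => ?_
      rw [Finset.sum_ite_eq]
      simp [jacobianMinor])
    hdet
  exact ⟨T, hT, y, tbar, hyc, hy0, ht0, hyt, fun g hg =>
    relations_vanish_of_jacobian f _ hdet hD hy0 ht0 hyt (fun i => hyf _ ⟨i, rfl⟩) hg⟩

end MvPowerSeries

/-! ### Tougeron's correction of approximate families. -/

namespace MvPowerSeries

variable {K : Type*} [Field K] {σ τ ι T : Type}

lemma le_weightedOrder_X (w : σ → ℕ) (i : σ) :
    (w i : ℕ∞) ≤ (X i : MvPowerSeries σ K).weightedOrder w := by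
  classical
  refine nat_le_weightedOrder w fun d hd => ?_
  rw [X, coeff_monomial_ne]
  rintro rfl
  rw [Finsupp.weight_single] at hd
  simp at hd

lemma le_weightedOrder_substHom [Finite σ] {a : σ → MvPowerSeries τ K}
    (ha : ∀ i, constantCoeff (a i) = 0) (w : τ → ℕ) {k : ℕ∞} (hk : ∀ i, k ≤ (a i).weightedOrder w)
    {f : MvPowerSeries σ K} (hf : constantCoeff f = 0) :
    k ≤ (substHom a f).weightedOrder w := by
  rw [substHom_eq ha]
  refine le_trans ?_ (le_weightedOrder_subst w (hasSubst_of_constantCoeff_zero ha) f)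
  refine le_iInf₂ fun d hd => ?_
  have hd0 : d ≠ 0 := by
    rintro rfl
    exact hd (by rw [coeff_zero_eq_constantCoeff_apply, hf])
  obtain ⟨i, hi⟩ := Finsupp.ne_iff.1 hd0
  rw [Finsupp.weight_apply, Finsupp.sum]
  refine le_trans ?_ (Finset.single_le_sum (f := fun i => d i • (weightedOrder w ∘ a) i)
    (fun _ _ => zero_le) (Finsupp.mem_support_iff.2 hi))
  refine (hk i).trans ?_
  change _ ≤ d i • (a i).weightedOrder w
  rw [nsmul_eq_mul]
  exact le_mul_of_one_le_left zero_le (by exact_mod_cast Nat.one_le_iff_ne_zero.2 hi)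

variable [Fintype σ] [Fintype τ] [Fintype T] [Fintype ι] [DecidableEq ι] {v : AbsoluteValue K ℝ}

/-- Tougeron's argument: a convergent family through the formal solution, along which the series
`f` vanish modulo the square of `A`, can be corrected to a family of solutions when a Jacobian
minor is equal to `A` up to a unit. -/
theorem hasConvergentFamily_of_sq_dvd {ybar : τ → MvPowerSeries σ K}
    {f : ι → MvPowerSeries (σ ⊕ τ) K} {M : Matrix τ ι (MvPowerSeries (σ ⊕ τ) K)}
    {δ : MvPowerSeries (σ ⊕ τ) K} (hf : ∀ i, f i ∈ convergentRelations v ybar)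
    (hM : ∀ k j, M k j ∈ convergent v (σ ⊕ τ))
    (hJ : ∀ i j, ∑ k, pderiv K (Sum.inr k) (f i) * M k j = if i = j then δ else 0)
    {A e : MvPowerSeries (σ ⊕ T) K} {Y : τ → MvPowerSeries (σ ⊕ T) K}
    {G : ι → MvPowerSeries (σ ⊕ T) K} {t : T → MvPowerSeries σ K}
    (hA : A ∈ convergent v (σ ⊕ T)) (he : e ∈ convergent v (σ ⊕ T))
    (hY : ∀ k, Y k ∈ convergent v (σ ⊕ T)) (hG : ∀ i, G i ∈ convergent v (σ ⊕ T))
    (hY0 : ∀ k, constantCoeff (Y k) = 0) (ht : ∀ i, constantCoeff (t i) = 0)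
    (he0 : constantCoeff e ≠ 0)
    (hfY : ∀ i, substHom (Sum.elim (fun i => X (Sum.inl i)) Y) (f i) = A ^ 2 * G i)
    (hδY : substHom (Sum.elim (fun i => X (Sum.inl i)) Y) δ = A * e)
    (hAt : substHom (Sum.elim X t) A ≠ 0)
    (hYt : ∀ k, substHom (Sum.elim X t) (Y k) = ybar k) :
    HasConvergentFamily v (Set.range f) ybar := by
  have hXt := constantCoeff_sumElim_eq_zero (fun i : σ => constantCoeff_X (R := K) i) ht
  have hXY := constantCoeff_sumElim_eq_zero (constantCoeff_X_inl (K := K) (σ := σ) (τ := T)) hY0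
  -- the error term vanishes along the formal solution
  have hG_t : ∀ i, substHom (Sum.elim X t) (G i) = 0 := by
    intro i
    have h1 := congrArg (substHom (Sum.elim X t)) (hfY i)
    rw [substHom_substHom hXY hXt, map_mul, map_pow] at h1
    have h2 : (fun j => substHom (Sum.elim X t) (Sum.elim (fun i => X (Sum.inl i)) Y j)) =
        Sum.elim X ybar := by
      funext j
      rcases j with j | k
      · simp [substHom_X hXt]
      · exact hYt k
    rw [h2, (hf i).2] at h1
    exact (mul_eq_zero.1 h1.symm).resolve_left (pow_ne_zero 2 hAt)
  have hG0 : ∀ i, constantCoeff (G i) = 0 := fun i => by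
    rw [← constantCoeff_substHom (Sum.elim X t), hG_t, map_zero]
  set inc : MvPowerSeries (σ ⊕ T) K →ₐ[K] MvPowerSeries ((σ ⊕ T) ⊕ ι) K :=
    substHom fun i => X (Sum.inl i) with hinc
  have hincc : ∀ {g : MvPowerSeries (σ ⊕ T) K}, g ∈ convergent v (σ ⊕ T) →
      inc g ∈ convergent v ((σ ⊕ T) ⊕ ι) := fun hg =>
    substHom_mem_convergent (fun i => constantCoeff_X _) (fun i => X_mem_convergent _) hg
  have hinc0 : ∀ g, constantCoeff (inc g) = constantCoeff g := fun g => constantCoeff_substHom _ g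
  -- The correction is `A * m`, where `m` is `M(x, Y)` applied to new unknowns indexed by `ι`. The
  -- Jacobian matrix turns `M` into `δ = A * e`, which supplies the second factor `A` in the linear
  -- term.
  set m : τ → MvPowerSeries ((σ ⊕ T) ⊕ ι) K := fun k =>
    ∑ j, inc (substHom (Sum.elim (fun i => X (Sum.inl i)) Y) (M k j)) * X (Sum.inr j) with hm
  have hXYc : ∀ i, Sum.elim (fun i => X (Sum.inl i)) Y i ∈ convergent v (σ ⊕ T) := by
    rintro (i | i)
    · exact X_mem_convergent _
    · exact hY i
  have hmc : ∀ k, m k ∈ convergent v ((σ ⊕ T) ⊕ ι) := fun k => sum_mem fun j _ =>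
    mul_mem (hincc (substHom_mem_convergent hXY hXYc (hM k j))) (X_mem_convergent _)
  have hm0 : ∀ k, constantCoeff (m k) = 0 := fun k => by simp [m]
  set a : σ ⊕ τ → MvPowerSeries ((σ ⊕ T) ⊕ ι) K :=
    Sum.elim (fun i => X (Sum.inl (Sum.inl i))) fun k => inc (Y k) with ha_def
  set b : σ ⊕ τ → MvPowerSeries ((σ ⊕ T) ⊕ ι) K := Sum.elim 0 fun k => inc A * m k with hb_def
  have ha : ∀ i, constantCoeff (a i) = 0 :=
    constantCoeff_sumElim_eq_zero (fun i => constantCoeff_X _) (fun k => by rw [hinc0, hY0])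
  have hb : ∀ i, constantCoeff (b i) = 0 :=
    constantCoeff_sumElim_eq_zero (fun i => by simp) (fun k => by rw [map_mul, hm0, mul_zero])
  have hac : ∀ i, a i ∈ convergent v ((σ ⊕ T) ⊕ ι) := by
    rintro (i | i)
    · exact X_mem_convergent _
    · exact hincc (hY i)
  have hbc : ∀ i, b i ∈ convergent v ((σ ⊕ T) ⊕ ι) := by
    rintro (i | i)
    · exact zero_mem _
    · exact mul_mem (hincc hA) (hmc i)
  have hab : ∀ i, constantCoeff (Sum.elim a b i) = 0 := constantCoeff_sumElim_eq_zero ha hb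
  have habc : ∀ i, Sum.elim a b i ∈ convergent v ((σ ⊕ T) ⊕ ι) := by
    rintro (i | i)
    · exact hac i
    · exact hbc i
  have hainc : ∀ g, substHom a g = inc (substHom (Sum.elim (fun i => X (Sum.inl i)) Y) g) := by
    intro g
    rw [hinc, substHom_substHom hXY (fun i => constantCoeff_X _)]
    congr 2
    funext j
    rcases j with i | k
    · simp only [a, Sum.elim_inl]
      rw [substHom_X (fun i => constantCoeff_X _)]
    · rfl
  choose q hqc _ hq using fun i => exists_taylor v (f i)
  set N : ι → MvPowerSeries ((σ ⊕ T) ⊕ ι) K := fun i =>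
    ∑ k, ∑ l, m k * m l * substHom (Sum.elim a b) (q i (Sum.inr k) (Sum.inr l)) with hN
  set H : ι → MvPowerSeries ((σ ⊕ T) ⊕ ι) K := fun i =>
    inc (G i) + X (Sum.inr i) * inc e + N i with hH
  have hHc : ∀ i, H i ∈ convergent v ((σ ⊕ T) ⊕ ι) := fun i =>
    add_mem (add_mem (hincc (hG i)) (mul_mem (X_mem_convergent _) (hincc he)))
      (sum_mem fun k _ => sum_mem fun l _ => mul_mem (mul_mem (hmc k) (hmc l))
        (substHom_mem_convergent hab habc (hqc i (hf i).1 _ _)))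
  -- All three parts of the Taylor expansion contain `A ^ 2`: the value by hypothesis, the linear
  -- part through `δ`, the quadratic part through two corrections. What remains is the system `H =
  -- 0`.
  have hfH : ∀ i, substHom (fun j => a j + b j) (f i) = inc A ^ 2 * H i := by
    intro i
    rw [hq i a b ha hb, hainc, hfY, map_mul, map_pow]
    have h1 : ∑ k, b k * substHom a (pderiv K k (f i)) =
        inc A ^ 2 * (X (Sum.inr i) * inc e) := by
      rw [Fintype.sum_sum_type]
      simp only [b, Sum.elim_inl, Sum.elim_inr, Pi.zero_apply, zero_mul, Finset.sum_const_zero,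
        zero_add]
      have h2 : ∀ j, ∑ k, substHom a (pderiv K (Sum.inr k) (f i)) * substHom a (M k j) =
          if i = j then inc A * inc e else 0 := by
        intro j
        have h3 := congrArg (substHom a) (hJ i j)
        rw [map_sum] at h3
        simp only [map_mul] at h3
        rw [h3]
        split_ifs
        · rw [hainc, hδY, map_mul]
        · rw [map_zero]
      calc _ = inc A * ∑ j, X (Sum.inr j) *
            ∑ k, substHom a (pderiv K (Sum.inr k) (f i)) * substHom a (M k j) := by
            simp only [m, Finset.mul_sum, Finset.sum_mul, ← hainc]
            rw [Finset.sum_comm]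
            refine Finset.sum_congr rfl fun j _ => Finset.sum_congr rfl fun k _ => ?_
            ring
        _ = _ := by
            simp only [h2, mul_ite, mul_zero]
            rw [Finset.sum_ite_eq]
            simp only [Finset.mem_univ, if_true]
            ring
    have h4 : ∑ k, ∑ l, b k * b l * substHom (Sum.elim a b) (q i k l) = inc A ^ 2 * N i := by
      simp only [Fintype.sum_sum_type, b, Sum.elim_inl, Sum.elim_inr, Pi.zero_apply, zero_mul,
        mul_zero, Finset.sum_const_zero, zero_add, N, Finset.mul_sum]
      refine Finset.sum_congr rfl fun k _ => Finset.sum_congr rfl fun l _ => ?_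
      ring
    rw [h1, h4, hH]
    ring
  set c : K := (constantCoeff e)⁻¹ with hc_def
  have hc : c * constantCoeff e = 1 := inv_mul_cancel₀ he0
  have hc0 : c ≠ 0 := inv_ne_zero he0
  -- Normalizing by the constant term of the unit `e` cancels the linear term of `H` in the
  -- unknowns, as the implicit function theorem requires.
  set Φ : ι → MvPowerSeries ((σ ⊕ T) ⊕ ι) K := fun i => X (Sum.inr i) - C c * H i with hΦ
  have hΦc : ∀ i, Φ i ∈ convergent v ((σ ⊕ T) ⊕ ι) := fun i =>
    sub_mem (X_mem_convergent _) (mul_mem (C_mem_convergent _) (hHc i))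
  have hwinc : ∀ g, constantCoeff g = 0 → 2 ≤ (inc g).weightedOrder implicitWeight := fun g hg =>
    le_weightedOrder_substHom (fun i => constantCoeff_X _) _
      (fun i => le_weightedOrder_X implicitWeight (Sum.inl i)) hg
  have hwX : ∀ j : ι, 1 ≤ (X (Sum.inr j) :
      MvPowerSeries ((σ ⊕ T) ⊕ ι) K).weightedOrder implicitWeight := fun j =>
    le_weightedOrder_X implicitWeight (Sum.inr j)
  have hwm : ∀ k, 1 ≤ (m k).weightedOrder implicitWeight := fun k =>
    le_weightedOrder_sum fun j _ => (hwX j).trans ((le_add_left le_rfl).trans (le_weightedOrder_mul _))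
  have hwmul : ∀ f g : MvPowerSeries ((σ ⊕ T) ⊕ ι) K, 2 ≤ f.weightedOrder implicitWeight →
      2 ≤ (f * g).weightedOrder implicitWeight := fun f g hf =>
    hf.trans ((le_add_right le_rfl).trans (le_weightedOrder_mul _))
  have hΦw : ∀ i, 2 ≤ (Φ i).weightedOrder implicitWeight := by
    intro i
    have h1 : Φ i = inc (1 - C c * e) * X (Sum.inr i) - (inc (G i) + N i) * C c := by
      simp only [Φ, H, map_sub, map_mul, map_one]
      rw [hinc, substHom_C]
      ring
    rw [h1]
    refine le_weightedOrder_sub (hwmul _ _ (hwinc _ (by simp [hc]))) (hwmul _ _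
      (le_weightedOrder_add (hwinc _ (hG0 i)) (le_weightedOrder_sum fun k _ =>
        le_weightedOrder_sum fun l _ => hwmul _ _ ?_)))
    refine le_trans ?_ (le_weightedOrder_mul _)
    rw [← one_add_one_eq_two]
    exact add_le_add (hwm k) (hwm l)
  obtain ⟨z, hzc, hz0, hz⟩ := exists_implicit hΦw hΦc
  have hXz := constantCoeff_sumElim_eq_zero (fun i : σ ⊕ T => constantCoeff_X (R := K) i) hz0
  have hXzc : ∀ i, Sum.elim X z i ∈ convergent v (σ ⊕ T) := by
    rintro (i | i)
    · exact X_mem_convergent _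
    · exact hzc i
  have hev : ∀ g, substHom (Sum.elim X z) (inc g) = g := fun g => by
    rw [hinc, substHom_rename hXz]
    exact substHom_X_eq g
  have hHz : ∀ i, substHom (Sum.elim X z) (H i) = 0 := by
    intro i
    have h1 := hz i
    simp only [Φ, map_sub, map_mul, substHom_X hXz, substHom_C, Sum.elim_inr] at h1
    rw [sub_eq_self] at h1
    refine (mul_eq_zero.1 h1).resolve_left fun h => hc0 ?_
    simpa using congrArg constantCoeff h
  set y : τ → MvPowerSeries (σ ⊕ T) K := fun k =>
    substHom (Sum.elim X z) (inc (Y k) + inc A * m k) with hy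
  have hy0 : ∀ k, constantCoeff (y k) = 0 := fun k => by
    simp only [y, constantCoeff_substHom, map_add, map_mul, hinc0, hY0, hm0, mul_zero, add_zero]
  refine ⟨T, inferInstance, y, t, fun k => substHom_mem_convergent hXz hXzc
    (add_mem (hincc (hY k)) (mul_mem (hincc hA) (hmc k))), hy0, ht, fun k => ?_, ?_⟩
  -- Along the formal solution `G` vanishes, so zero also solves the implicit equation. Uniqueness
  -- gives `z = 0` there, and the correction does not move `ybar`.
  · have hzt : (fun i => substHom (Sum.elim X t) (z i)) = (0 : ι → MvPowerSeries σ K) := by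
      have hst : ∀ i, constantCoeff (substHom (Sum.elim X t) (z i)) = 0 := fun i => by
        rw [constantCoeff_substHom, hz0]
      have hX0 := constantCoeff_sumElim_eq_zero (b := (0 : ι → MvPowerSeries σ K)) hXt
        (fun i => by simp)
      refine implicit_unique hΦw hXt hst (fun i => by simp) (fun i => ?_) (fun i => ?_)
      · conv_rhs => rw [← hz i]
        rw [substHom_substHom hXz hXt]
        congr 2
        funext j
        rcases j with j | j
        · simp only [Sum.elim_inl, substHom_X hXt]
        · rfl
      · have h1 : substHom (Sum.elim (Sum.elim X t) (0 : ι → MvPowerSeries σ K)) (inc (G i)) =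
            0 := by
          rw [hinc, substHom_rename hX0]
          exact hG_t i
        have h2 : ∀ k, substHom (Sum.elim (Sum.elim X t) (0 : ι → MvPowerSeries σ K)) (m k) =
            0 := fun k => by
          simp only [m, map_sum, map_mul, substHom_X hX0]
          simp
        simp only [Φ, H, N, map_sub, map_mul, map_add, map_sum, substHom_X hX0, h1, h2]
        simp
    have h3 : substHom (Sum.elim X t) (substHom (Sum.elim X z) (m k)) = 0 := by
      simp only [m, map_sum, map_mul, substHom_X hXz, Sum.elim_inr, congrFun hzt]
      simp
    simp only [y, map_add, map_mul, hev, h3, mul_zero, add_zero, hYt]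
  · rintro _ ⟨i, rfl⟩
    have h1 := congrArg (substHom (Sum.elim X z)) (hfH i)
    rw [map_mul, hHz, mul_zero, substHom_substHom (constantCoeff_add_eq_zero ha hb) hXz] at h1
    rw [← h1]
    congr 2
    funext j
    rcases j with j | k
    · simp [a, b, substHom_X hXz]
    · simp only [a, b, Sum.elim_inr, y]

/-- Approximate families through a formal solution modulo the square of `A` can be moved onto the
formal solution by adding parameters. -/
theorem hasConvergentFamily_of_approximation {ybar : τ → MvPowerSeries σ K}
    {f : ι → MvPowerSeries (σ ⊕ τ) K} {M : Matrix τ ι (MvPowerSeries (σ ⊕ τ) K)}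
    {δ : MvPowerSeries (σ ⊕ τ) K} (hf : ∀ i, f i ∈ convergentRelations v ybar)
    (hM : ∀ k j, M k j ∈ convergent v (σ ⊕ τ)) (hδ : δ ∈ convergent v (σ ⊕ τ))
    (hJ : ∀ i j, ∑ k, pderiv K (Sum.inr k) (f i) * M k j = if i = j then δ else 0)
    {A e : MvPowerSeries (σ ⊕ T) K} {Y : τ → MvPowerSeries (σ ⊕ T) K}
    {G : ι → MvPowerSeries (σ ⊕ T) K} {t : T → MvPowerSeries σ K}
    (hA : A ∈ convergent v (σ ⊕ T)) (he : e ∈ convergent v (σ ⊕ T))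
    (hY : ∀ k, Y k ∈ convergent v (σ ⊕ T)) (hG : ∀ i, G i ∈ convergent v (σ ⊕ T))
    (hY0 : ∀ k, constantCoeff (Y k) = 0) (ht : ∀ i, constantCoeff (t i) = 0)
    (he0 : constantCoeff e ≠ 0) (hA0 : constantCoeff A = 0)
    (hfY : ∀ i, substHom (Sum.elim (fun i => X (Sum.inl i)) Y) (f i) = A ^ 2 * G i)
    (hδY : substHom (Sum.elim (fun i => X (Sum.inl i)) Y) δ = A * e)
    (hAt : substHom (Sum.elim X t) A ≠ 0) (u : τ → MvPowerSeries σ K)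
    (hYt : ∀ k, ybar k = substHom (Sum.elim X t) (Y k) + substHom (Sum.elim X t) A ^ 2 * u k) :
    HasConvergentFamily v (Set.range f) ybar := by
  have hXY := constantCoeff_sumElim_eq_zero (constantCoeff_X_inl (K := K) (σ := σ) (τ := T)) hY0
  set r : σ ⊕ T → MvPowerSeries (σ ⊕ (T ⊕ τ)) K :=
    Sum.elim (fun i => X (Sum.inl i)) fun j => X (Sum.inr (Sum.inl j)) with hr_def
  have hr : ∀ i, constantCoeff (r i) = 0 :=
    constantCoeff_sumElim_eq_zero (fun i => constantCoeff_X _) (fun i => constantCoeff_X _)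
  have hrc : ∀ i, r i ∈ convergent v (σ ⊕ (T ⊕ τ)) := by
    rintro (i | i) <;> exact X_mem_convergent _
  have hRc : ∀ {g}, g ∈ convergent v (σ ⊕ T) → substHom r g ∈ convergent v (σ ⊕ (T ⊕ τ)) :=
    fun hg => substHom_mem_convergent hr hrc hg
  -- One new parameter per unknown stands for `u k` minus its constant term, so that `Y + A ^ 2 * n`
  -- specializes exactly to `ybar`.
  set n : τ → MvPowerSeries (σ ⊕ (T ⊕ τ)) K := fun k =>
    C (constantCoeff (u k)) + X (Sum.inr (Sum.inr k)) with hn_def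
  have hnc : ∀ k, n k ∈ convergent v (σ ⊕ (T ⊕ τ)) := fun k =>
    add_mem (C_mem_convergent _) (X_mem_convergent _)
  set a : σ ⊕ τ → MvPowerSeries (σ ⊕ (T ⊕ τ)) K :=
    Sum.elim (fun i => X (Sum.inl i)) fun k => substHom r (Y k) with ha_def
  set b : σ ⊕ τ → MvPowerSeries (σ ⊕ (T ⊕ τ)) K :=
    Sum.elim 0 fun k => substHom r A ^ 2 * n k with hb_def
  have ha : ∀ i, constantCoeff (a i) = 0 :=
    constantCoeff_sumElim_eq_zero (fun i => constantCoeff_X _) (fun k => by simp [hY0])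
  have hb : ∀ i, constantCoeff (b i) = 0 :=
    constantCoeff_sumElim_eq_zero (fun i => by simp) (fun k => by simp [hA0])
  have hab := constantCoeff_sumElim_eq_zero ha hb
  have habc : ∀ i, Sum.elim a b i ∈ convergent v (σ ⊕ (T ⊕ τ)) := by
    rintro ((i | i) | (i | i))
    · exact X_mem_convergent _
    · exact hRc (hY i)
    · exact zero_mem _
    · exact mul_mem (pow_mem (hRc hA) 2) (hnc i)
  have hra : ∀ g, substHom a g = substHom r (substHom (Sum.elim (fun i => X (Sum.inl i)) Y) g) := by
    intro g
    rw [substHom_substHom hXY hr]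
    congr 2
    funext j
    rcases j with j | j
    · simp only [a, Sum.elim_inl, substHom_X hr, r]
    · rfl
  -- Changing `Y` by a multiple of `A ^ 2` changes all values by multiples of `A ^ 2`. The errors
  -- remain divisible by `A ^ 2`, and `δ` becomes `A * (e + A * s)`, whose second factor is still a
  -- unit because `A` has no constant term.
  have key : ∀ g ∈ convergent v (σ ⊕ τ), ∃ s ∈ convergent v (σ ⊕ (T ⊕ τ)),
      substHom (fun i => a i + b i) g =
        substHom r (substHom (Sum.elim (fun i => X (Sum.inl i)) Y) g) + substHom r A ^ 2 * s := by
    intro g hg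
    classical
    obtain ⟨q, hqc, hq⟩ := exists_substHom_add_mul_eq v g
    refine ⟨∑ k, n k * substHom (Sum.elim a b) (q (Sum.inr k)), sum_mem fun k _ =>
      mul_mem (hnc k) (substHom_mem_convergent hab habc (hqc hg _)), ?_⟩
    rw [hq a b ha hb, hra, Fintype.sum_sum_type, Finset.mul_sum]
    simp only [b, Sum.elim_inl, Sum.elim_inr, Pi.zero_apply, zero_mul, Finset.sum_const_zero,
      zero_add, mul_assoc]
  choose s hsc hs using fun i => key (f i) (hf i).1
  obtain ⟨sδ, hsδc, hsδ⟩ := key δ hδ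
  have hfun : (fun i => a i + b i) = Sum.elim (fun i => X (Sum.inl i))
      (fun k => substHom r (Y k) + substHom r A ^ 2 * n k) := by
    funext j
    rcases j with j | j <;> simp [a, b]
  rw [hfun] at hsδ
  simp only [hfun] at hs
  set t' : T ⊕ τ → MvPowerSeries σ K := Sum.elim t fun k => u k - C (constantCoeff (u k))
  have ht' : ∀ i, constantCoeff (t' i) = 0 :=
    constantCoeff_sumElim_eq_zero ht (fun k => by simp)
  have hXt' := constantCoeff_sumElim_eq_zero (fun i : σ => constantCoeff_X (R := K) i) ht'
  have hRt : ∀ g, substHom (Sum.elim X t') (substHom r g) = substHom (Sum.elim X t) g := by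
    intro g
    rw [substHom_substHom hr hXt']
    congr 2
    funext j
    rcases j with j | j <;> simp [r, substHom_X hXt', t']
  refine hasConvergentFamily_of_sq_dvd (T := T ⊕ τ) (A := substHom r A)
    (e := substHom r e + substHom r A * sδ)
    (Y := fun k => substHom r (Y k) + substHom r A ^ 2 * n k)
    (G := fun i => substHom r (G i) + s i) (t := t') hf hM hJ (hRc hA)
    (add_mem (hRc he) (mul_mem (hRc hA) hsδc))
    (fun k => add_mem (hRc (hY k)) (mul_mem (pow_mem (hRc hA) 2) (hnc k)))
    (fun i => add_mem (hRc (hG i)) (hsc i)) (fun k => by simp [hY0, hA0]) ht'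
    (by simpa [hA0] using he0) (fun i => ?_) ?_ (by rwa [hRt]) (fun k => ?_)
  · rw [hs, hfY, map_mul, map_pow]
    ring
  · rw [hsδ, hδY, map_mul]
    ring
  · simp only [map_add, map_mul, map_pow, hRt, hYt k, n, substHom_C, substHom_X hXt']
    simp [t']

end MvPowerSeries

/-! ### Weierstrass preparation and the reduction to fewer variables. -/

namespace MvPowerSeries

variable {K : Type*} [Field K] {ρ σ τ ι : Type}

section Preparation

/-- The power series in the distinguished variable obtained by setting all others to zero. -/
noncomputable def noneSpec : MvPowerSeries (Option ρ) K →+* PowerSeries K :=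
  (PowerSeries.map constantCoeff).comp (optionEquivLeft ρ K : _ →+* PowerSeries (MvPowerSeries ρ K))

lemma noneSpec_apply (f : MvPowerSeries (Option ρ) K) :
    noneSpec f = PowerSeries.map constantCoeff (optionEquivLeft ρ K f) := rfl

lemma coeff_noneSpec (n : ℕ) (f : MvPowerSeries (Option ρ) K) :
    PowerSeries.coeff n (noneSpec f) = coeff (Finsupp.single none n) f := by
  rw [noneSpec_apply, PowerSeries.coeff_map, ← coeff_zero_eq_constantCoeff_apply,
    coeff_coeff_optionEquivLeft, Finsupp.optionElim_zero]

@[simp] lemma noneSpec_X_none : noneSpec (X none : MvPowerSeries (Option ρ) K) = PowerSeries.X := by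
  rw [noneSpec_apply, optionEquivLeft_X_none, PowerSeries.map_X]

@[simp] lemma noneSpec_X_some (i : ρ) :
    noneSpec (X (some i) : MvPowerSeries (Option ρ) K) = 0 := by
  rw [noneSpec_apply, optionEquivLeft_X_some, PowerSeries.map_C, constantCoeff_X, map_zero]

lemma constantCoeff_eq_noneSpec (f : MvPowerSeries (Option ρ) K) :
    constantCoeff f = PowerSeries.coeff 0 (noneSpec f) := by
  rw [coeff_noneSpec, Finsupp.single_zero, coeff_zero_eq_constantCoeff_apply]

lemma one_le_weightedOrder_of_noneSpec {f : MvPowerSeries (Option ρ) K} (h : noneSpec f = 0) :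
    1 ≤ f.weightedOrder someWeight := by
  classical
  refine nat_le_weightedOrder (n := 1) someWeight fun d hd => ?_
  have hd0 : d = Finsupp.single none (d none) := by
    ext o
    cases o with
    | none => simp
    | some i =>
      rw [Finsupp.single_apply, if_neg (by simp)]
      have h0 : Finsupp.weight someWeight d = 0 := by omega
      rw [Finsupp.weight_apply, Finsupp.sum, Finset.sum_eq_zero_iff] at h0
      by_contra hne
      simpa [someWeight, hne] using h0 (some i) (Finsupp.mem_support_iff.2 hne)
  rw [hd0, ← coeff_noneSpec, h, map_zero]

variable [Finite ρ]

@[simp] lemma noneSpec_someEmb (f : MvPowerSeries ρ K) :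
    noneSpec (someEmb f) = PowerSeries.C (constantCoeff f) := by
  rw [noneSpec_apply, optionEquivLeft_someEmb, PowerSeries.map_C]

/-- The polynomial in the distinguished variable with given coefficients. -/
noncomputable def nonePoly {q : ℕ} (R : Fin q → MvPowerSeries ρ K) : MvPowerSeries (Option ρ) K :=
  ∑ j, someEmb (R j) * X none ^ (j : ℕ)

/-- The monic polynomial in the distinguished variable with given lower coefficients. -/
noncomputable def noneMonic {q : ℕ} (R : Fin q → MvPowerSeries ρ K) : MvPowerSeries (Option ρ) K :=
  X none ^ q + nonePoly R

lemma noneSpec_nonePoly {q : ℕ} (R : Fin q → MvPowerSeries ρ K) :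
    noneSpec (nonePoly R) = ∑ j, PowerSeries.C (constantCoeff (R j)) * PowerSeries.X ^ (j : ℕ) := by
  simp [nonePoly]

lemma noneSpec_noneMonic {q : ℕ} {R : Fin q → MvPowerSeries ρ K}
    (hR : ∀ j, constantCoeff (R j) = 0) : noneSpec (noneMonic R) = PowerSeries.X ^ q := by
  simp [noneMonic, noneSpec_nonePoly, hR]

lemma constantCoeff_nonePoly {q : ℕ} (R : Fin q → MvPowerSeries ρ K) :
    constantCoeff (nonePoly R) = ∑ j, constantCoeff (R j) * 0 ^ (j : ℕ) := by
  simp [nonePoly]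

lemma nonePoly_mem_convergent {v : AbsoluteValue K ℝ} {q : ℕ} {R : Fin q → MvPowerSeries ρ K}
    (hR : ∀ j, R j ∈ convergent v ρ) : nonePoly R ∈ convergent v (Option ρ) :=
  sum_mem fun j _ => mul_mem (substHom_mem_convergent (fun _ => constantCoeff_X _)
    (fun _ => X_mem_convergent _) (hR j)) (pow_mem (X_mem_convergent _) _)

lemma substHom_nonePoly {q : ℕ} {Z : Option ρ → MvPowerSeries σ K}
    (hZ : ∀ i, constantCoeff (Z i) = 0) (R : Fin q → MvPowerSeries ρ K) :
    substHom Z (nonePoly R) = ∑ j, substHom (fun i => Z (some i)) (R j) * Z none ^ (j : ℕ) := by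
  simp only [nonePoly, map_sum, map_mul, map_pow, substHom_X hZ, substHom_rename hZ]

section Divide

variable {q : ℕ} {W : MvPowerSeries (Option ρ) K}

omit [Finite ρ] in
lemma one_le_weightedOrder_X_pow_sub (hW : noneSpec W = PowerSeries.X ^ q) :
    1 ≤ (X none ^ q - W).weightedOrder someWeight :=
  one_le_weightedOrder_of_noneSpec (by rw [map_sub, map_pow, noneSpec_X_none, hW, sub_self])

theorem exists_eq_mul_add_nonePoly (hW : noneSpec W = PowerSeries.X ^ q)
    (g : MvPowerSeries (Option ρ) K) :
    ∃ (Q : MvPowerSeries (Option ρ) K) (R : Fin q → MvPowerSeries ρ K),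
      g = W * Q + nonePoly R := by
  obtain ⟨Q, R, h⟩ := exists_division (one_le_weightedOrder_X_pow_sub hW) g
  rw [sub_sub_cancel] at h
  exact ⟨Q, R, h⟩

theorem exists_eq_mul_add_nonePoly_convergent {v : AbsoluteValue K ℝ}
    (hW : noneSpec W = PowerSeries.X ^ q) (hWc : W ∈ convergent v (Option ρ))
    {g : MvPowerSeries (Option ρ) K} (hg : g ∈ convergent v (Option ρ)) :
    ∃ Q ∈ convergent v (Option ρ), ∃ R : Fin q → MvPowerSeries ρ K,
      (∀ j, R j ∈ convergent v ρ) ∧ g = W * Q + nonePoly R := by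
  obtain ⟨Q, hQ, R, hR, h⟩ := exists_division_convergent (one_le_weightedOrder_X_pow_sub hW)
    (sub_mem (pow_mem (X_mem_convergent _) _) hWc) hg
  rw [sub_sub_cancel] at h
  exact ⟨Q, hQ, R, hR, h⟩

theorem eq_zero_of_mul_add_nonePoly_eq_zero (hW : noneSpec W = PowerSeries.X ^ q)
    {Q : MvPowerSeries (Option ρ) K} {R : Fin q → MvPowerSeries ρ K}
    (h : W * Q + nonePoly R = 0) : Q = 0 ∧ ∀ j, R j = 0 := by
  refine division_unique (one_le_weightedOrder_X_pow_sub hW) ?_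
  rwa [sub_sub_cancel]

/-- The Weierstrass preparation theorem for formal power series. -/
theorem exists_eq_noneMonic_mul {F : MvPowerSeries (Option ρ) K}
    (hF : ∃ p, coeff (Finsupp.single none p) F ≠ 0) :
    ∃ (p : ℕ) (R : Fin p → MvPowerSeries ρ K) (u : MvPowerSeries (Option ρ) K),
      (∀ j, constantCoeff (R j) = 0) ∧ constantCoeff u ≠ 0 ∧ F = noneMonic R * u := by
  classical
  set p := Nat.find hF
  have hp : coeff (Finsupp.single none p) F ≠ 0 := Nat.find_spec hF
  have hmin : ∀ j < p, coeff (Finsupp.single none j) F = 0 := fun j hj =>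
    not_not.1 (Nat.find_min hF hj)
  set U := noneShift p F
  have hU : constantCoeff U ≠ 0 := by
    rw [← coeff_zero_eq_constantCoeff_apply, coeff_noneShift, zero_add]
    exact hp
  have hUU : U * U⁻¹ = 1 := MvPowerSeries.mul_inv_cancel U hU
  -- `F` differs from `X none ^ p * U` by terms that vanish when the other variables are set to
  -- zero, so division by `F * U⁻¹` is possible. Dividing `X none ^ p` by it yields a unit quotient,
  -- and the remainder gives the Weierstrass polynomial.
  have hW : noneSpec (F * U⁻¹) = PowerSeries.X ^ p := by
    have h1 : F = X none ^ p * U + nonePoly fun j : Fin p => noneCoeff (j : ℕ) F :=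
      eq_X_pow_mul_noneShift_add p F
    have h2 : noneSpec (nonePoly fun j : Fin p => noneCoeff (j : ℕ) F) = 0 := by
      rw [noneSpec_nonePoly]
      refine Finset.sum_eq_zero fun j _ => ?_
      rw [← coeff_zero_eq_constantCoeff_apply, coeff_noneCoeff, Finsupp.optionElim_zero,
        hmin j j.2, map_zero, zero_mul]
    conv_lhs => rw [h1]
    rw [add_mul, mul_assoc, hUU, map_add, map_mul, map_mul, h2, map_pow, noneSpec_X_none]
    simp
  obtain ⟨Q, R, h⟩ := exists_eq_mul_add_nonePoly hW (X none ^ p)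
  have h1 := congrArg noneSpec h
  rw [map_add, map_mul, hW, map_pow, noneSpec_X_none, noneSpec_nonePoly] at h1
  have hR : ∀ j, constantCoeff (R j) = 0 := by
    intro j
    have h2 := congrArg (PowerSeries.coeff (j : ℕ)) h1
    rw [map_add, PowerSeries.coeff_X_pow, PowerSeries.coeff_X_pow_mul', if_neg (by omega),
      if_neg (by omega), zero_add, map_sum, Finset.sum_eq_single j] at h2
    · rw [PowerSeries.coeff_C_mul, PowerSeries.coeff_X_pow_self, mul_one] at h2
      exact h2.symm
    · intro i _ hij
      rw [PowerSeries.coeff_C_mul, PowerSeries.coeff_X_pow, if_neg, mul_zero]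
      exact fun h => hij (Fin.ext h.symm)
    · simp
  have hQ : constantCoeff Q = 1 := by
    have h2 := congrArg (PowerSeries.coeff p) h1
    simp only [hR, map_zero, zero_mul, Finset.sum_const_zero, add_zero] at h2
    rw [PowerSeries.coeff_X_pow_self, PowerSeries.coeff_X_pow_mul', if_pos le_rfl,
      Nat.sub_self] at h2
    rw [constantCoeff_eq_noneSpec, ← h2]
  have hQ0 : constantCoeff Q ≠ 0 := by rw [hQ]; exact one_ne_zero
  have hQQ : Q * Q⁻¹ = 1 := MvPowerSeries.mul_inv_cancel Q hQ0
  refine ⟨p, fun j => -R j, U * Q⁻¹, fun j => by rw [map_neg, hR, neg_zero], ?_, ?_⟩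
  · rw [map_mul, constantCoeff_inv]
    exact mul_ne_zero hU (inv_ne_zero hQ0)
  · have h3 : noneMonic (fun j => -R j) = F * U⁻¹ * Q := by
      have : nonePoly (fun j => -R j) = -nonePoly R := by
        simp [nonePoly]
      rw [noneMonic, this]
      linear_combination h
    rw [h3]
    linear_combination (-F * Q * Q⁻¹) * hUU - F * hQQ

end Divide

end Preparation

section RegularStep

variable [Fintype σ] [Fintype τ] [Fintype ι] [DecidableEq ι] {v : AbsoluteValue K ℝ}

/-- The inductive step of the approximation theorem for a system whose Jacobian minor is regular
in the distinguished variable along the formal solution. -/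
theorem hasConvergentFamily_of_regular
    (IH : ∀ (τ' : Type) [Fintype τ'] (c : τ' → MvPowerSeries σ K),
      (∀ i, constantCoeff (c i) = 0) → HasConvergentFamily v (convergentRelations v c) c)
    {ybar : τ → MvPowerSeries (Option σ) K} (hybar : ∀ k, constantCoeff (ybar k) = 0)
    {f : ι → MvPowerSeries (Option σ ⊕ τ) K} {M : Matrix τ ι (MvPowerSeries (Option σ ⊕ τ) K)}
    {δ : MvPowerSeries (Option σ ⊕ τ) K} (hf : ∀ i, f i ∈ convergentRelations v ybar)
    (hM : ∀ k j, M k j ∈ convergent v (Option σ ⊕ τ)) (hδ : δ ∈ convergent v (Option σ ⊕ τ))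
    (hJ : ∀ i j, ∑ k, pderiv K (Sum.inr k) (f i) * M k j = if i = j then δ else 0)
    (hreg : ∃ p, coeff (Finsupp.single none p) (substHom (Sum.elim X ybar) δ) ≠ 0)
    (hδ0 : constantCoeff δ = 0) : HasConvergentFamily v (Set.range f) ybar := by
  obtain ⟨p, abar, u, habar, hu, hF⟩ := exists_eq_noneMonic_mul hreg
  set W : MvPowerSeries (Option σ) K := noneMonic abar with hW_def
  have hW : noneSpec W = PowerSeries.X ^ p := noneSpec_noneMonic habar
  have hW2 : noneSpec (W ^ 2) = PowerSeries.X ^ (p * 2) := by rw [map_pow, hW, pow_mul]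
  have hW0 : constantCoeff W = 0 := by
    have h1 := congrArg constantCoeff hF
    rw [constantCoeff_substHom, hδ0, map_mul] at h1
    exact (mul_eq_zero.1 h1.symm).resolve_right hu
  have hWne : W ≠ 0 := by
    intro h
    rw [h, map_zero] at hW
    exact pow_ne_zero p PowerSeries.X_ne_zero hW.symm
  -- The divisor is `W ^ 2` because Tougeron's argument needs an approximation modulo the square of
  -- `A`.
  choose w yc hyc using fun k => exists_eq_mul_add_nonePoly hW2 (ybar k)
  -- the coefficients of the Weierstrass polynomial and of the remainders, without constant terms
  let bar : Fin p ⊕ (τ × Fin (p * 2)) → MvPowerSeries σ K :=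
    Sum.elim abar fun kj => yc kj.1 kj.2 - C (constantCoeff (yc kj.1 kj.2))
  have hbar : ∀ i, constantCoeff (bar i) = 0 :=
    constantCoeff_sumElim_eq_zero habar (fun _ => by simp)
  obtain ⟨T, hT, y', t, hy'c, hy'0, ht0, hy't, hrel⟩ := IH _ bar hbar
  have hXbar := constantCoeff_sumElim_eq_zero (fun i : σ => constantCoeff_X (R := K) i) hbar
  have hXy' := constantCoeff_sumElim_eq_zero (constantCoeff_X_inl (K := K) (σ := σ) (τ := T)) hy'0
  have hXt := constantCoeff_sumElim_eq_zero (fun i : σ => constantCoeff_X (R := K) i) ht0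
  -- the generic Weierstrass polynomial and the generic remainders
  let A₁ : MvPowerSeries (Option (σ ⊕ (Fin p ⊕ (τ × Fin (p * 2))))) K :=
    noneMonic fun j : Fin p => X (Sum.inr (Sum.inl j))
  let Y₁ : τ → MvPowerSeries (Option (σ ⊕ (Fin p ⊕ (τ × Fin (p * 2))))) K := fun k =>
    nonePoly fun j : Fin (p * 2) => C (constantCoeff (yc k j)) + X (Sum.inr (Sum.inr (k, j)))
  have hA₁ : noneSpec A₁ = PowerSeries.X ^ p := noneSpec_noneMonic fun j => constantCoeff_X _
  have hA₁2 : noneSpec (A₁ ^ 2) = PowerSeries.X ^ (p * 2) := by rw [map_pow, hA₁, pow_mul]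
  have hA₁c : A₁ ∈ convergent v _ :=
    add_mem (pow_mem (X_mem_convergent _) _) (nonePoly_mem_convergent fun j => X_mem_convergent _)
  have hY₁c : ∀ k, Y₁ k ∈ convergent v _ := fun k =>
    nonePoly_mem_convergent fun j => add_mem (C_mem_convergent _) (X_mem_convergent _)
  have hY₁0 : ∀ k, constantCoeff (Y₁ k) = 0 := by
    intro k
    have h1 := congrArg constantCoeff (hyc k)
    rw [hybar, map_add, map_mul, map_pow, hW0, constantCoeff_nonePoly] at h1
    rw [constantCoeff_nonePoly]
    simpa using h1.symm
  let ξ : Option σ → MvPowerSeries (Option (σ ⊕ (Fin p ⊕ (τ × Fin (p * 2))))) K :=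
    fun o => o.elim (X none) fun i => X (some (Sum.inl i))
  have hξ0 : ∀ i, constantCoeff (ξ i) = 0 := by
    rintro (_ | i) <;> exact constantCoeff_X _
  have hξc : ∀ i, ξ i ∈ convergent v _ := by
    rintro (_ | i) <;> exact X_mem_convergent _
  have hξY := constantCoeff_sumElim_eq_zero hξ0 hY₁0
  have hξYc : ∀ i, Sum.elim ξ Y₁ i ∈ convergent v _ := by
    rintro (i | i)
    · exact hξc i
    · exact hY₁c i
  -- Division by the generic polynomial is convergent even though `W` is only formal. The
  -- coefficients `R` of the remainders involve the remaining base variables and the unknown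
  -- coefficients, but not the distinguished variable.
  choose Q hQc R hRc hQR using fun i => exists_eq_mul_add_nonePoly_convergent hA₁2
    (pow_mem hA₁c 2) (substHom_mem_convergent hξY hξYc (hf i).1)
  obtain ⟨e₁, he₁c, S, hSc, heS⟩ := exists_eq_mul_add_nonePoly_convergent hA₁ hA₁c
    (substHom_mem_convergent hξY hξYc hδ)
  -- specialization to the formal coefficients
  let B : Option (σ ⊕ (Fin p ⊕ (τ × Fin (p * 2)))) → MvPowerSeries (Option σ) K :=
    fun o => o.elim (X none) fun j => someEmb (Sum.elim X bar j)
  have hB : ∀ i, constantCoeff (B i) = 0 := by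
    rintro (_ | j)
    · exact constantCoeff_X _
    · change constantCoeff (someEmb (Sum.elim X bar j)) = 0
      rw [constantCoeff_substHom, hXbar]
  have hBsome : ∀ g, substHom (fun i => B (some i)) g = someEmb (substHom (Sum.elim X bar) g) := by
    intro g
    rw [substHom_substHom hXbar (fun i => constantCoeff_X _)]
    rfl
  have hBpoly : ∀ {q : ℕ} (R : Fin q → MvPowerSeries (σ ⊕ (Fin p ⊕ (τ × Fin (p * 2)))) K),
      substHom B (nonePoly R) = nonePoly fun j => substHom (Sum.elim X bar) (R j) := by
    intro q R
    rw [substHom_nonePoly hB, nonePoly]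
    simp only [hBsome]
    rfl
  have hBA : substHom B A₁ = W := by
    have h1 : A₁ = X none ^ p + nonePoly fun j : Fin p => X (Sum.inr (Sum.inl j)) := rfl
    rw [hW_def, noneMonic, h1, map_add, hBpoly, map_pow, substHom_X hB]
    simp only [substHom_X hXbar]
    rfl
  have hBY : ∀ k, substHom B (Y₁ k) = nonePoly (yc k) := by
    intro k
    rw [hBpoly]
    congr 1
    funext j
    rw [map_add, substHom_C, substHom_X hXbar]
    simp [bar]
  -- The formal solution agrees with its remainders modulo `W ^ 2`, hence so do the values of any
  -- series at them.
  have hcongr : ∀ g : MvPowerSeries (Option σ ⊕ τ) K, ∃ s, substHom (Sum.elim X ybar) g =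
      substHom B (substHom (Sum.elim ξ Y₁) g) + W ^ 2 * s := by
    intro g
    obtain ⟨q, -, hq⟩ := exists_substHom_add_mul_eq v g
    have h0 : ∀ k, constantCoeff (nonePoly (yc k)) = 0 := fun k => by
      rw [← hBY, constantCoeff_substHom, hY₁0]
    have ha := constantCoeff_sumElim_eq_zero
      (fun i : Option σ => constantCoeff_X (R := K) i) h0
    set a' : Option σ ⊕ τ → MvPowerSeries (Option σ) K :=
      Sum.elim X fun k => nonePoly (yc k) with ha'
    set b' : Option σ ⊕ τ → MvPowerSeries (Option σ) K :=
      Sum.elim (fun _ => 0) fun k => W ^ 2 * w k with hb'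
    have hb : ∀ i, constantCoeff (b' i) = 0 :=
      constantCoeff_sumElim_eq_zero (fun i : Option σ => by simp) (fun k => by simp [hW0])
    have h1 := hq a' b' ha hb
    have h2 : (fun i => a' i + b' i) = Sum.elim X ybar := by
      funext j
      rcases j with j | k
      · simp [a', b']
      · simp only [a', b', Sum.elim_inr]
        rw [hyc k, add_comm]
    have h3 : substHom B (substHom (Sum.elim ξ Y₁) g) =
        substHom a' g := by
      rw [substHom_substHom hξY hB]
      congr 2
      funext j
      rcases j with (_ | i) | k
      · simp only [Sum.elim_inl, ξ, Option.elim_none, substHom_X hB]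
        rfl
      · simp only [Sum.elim_inl, ξ, Option.elim_some, substHom_X hB]
        change someEmb (X i) = _
        rw [substHom_X (fun i => constantCoeff_X _)]
        rfl
      · exact hBY k
    rw [h2, ← h3, Fintype.sum_sum_type] at h1
    refine ⟨∑ k, w k * substHom (Sum.elim a' b') (q (Sum.inr k)), ?_⟩
    rw [h1, Finset.mul_sum]
    simp only [hb', Sum.elim_inl, Sum.elim_inr, zero_mul, Finset.sum_const_zero,
      zero_add, mul_assoc]
  -- Since `f i` vanishes at `ybar`, specializing the generic division gives a division of zero by
  -- `W ^ 2`. By uniqueness its remainder is zero, so the `R i j` are relations of the true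
  -- coefficients.
  have hR0 : ∀ i j, R i j ∈ convergentRelations v bar := by
    intro i j
    obtain ⟨s, hs⟩ := hcongr (f i)
    rw [(hf i).2, hQR i, map_add, map_mul, map_pow, hBA, hBpoly] at hs
    exact ⟨hRc i j, (eq_zero_of_mul_add_nonePoly_eq_zero hW2 (Q := substHom B (Q i) + s)
      (by linear_combination -hs)).2 j⟩
  obtain ⟨sδ, hsδ⟩ := hcongr δ
  rw [hF, heS, map_add, map_mul, hBA, hBpoly] at hsδ
  -- The same comparison with `δ(x, ybar) = W * u` shows that the remainder vanishes and that `e₁`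
  -- specializes to `u` modulo `W`. As `W` has no constant term, `e₁` inherits a nonzero one from
  -- `u`.
  obtain ⟨he₁u, hS⟩ := eq_zero_of_mul_add_nonePoly_eq_zero hW
    (Q := substHom B e₁ + W * sδ - u) (R := fun j => substHom (Sum.elim X bar) (S j))
    (by linear_combination -hsδ)
  have hS0 : ∀ j, S j ∈ convergentRelations v bar := fun j => ⟨hSc j, hS j⟩
  have he₁0 : constantCoeff e₁ ≠ 0 := by
    have h1 := congrArg constantCoeff he₁u
    rw [map_sub, map_add, map_mul, hW0, constantCoeff_substHom, zero_mul, add_zero, map_zero,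
      sub_eq_zero] at h1
    rwa [h1]
  -- specialization to the convergent family of coefficients
  let inc : σ ⊕ T → MvPowerSeries (Option σ ⊕ T) K :=
    Sum.elim (fun i => X (Sum.inl (some i))) fun j => X (Sum.inr j)
  have hinc : ∀ i, constantCoeff (inc i) = 0 := by
    rintro (i | i) <;> exact constantCoeff_X _
  have hincc : ∀ i, inc i ∈ convergent v _ := by
    rintro (i | i) <;> exact X_mem_convergent _
  let ψ : Option (σ ⊕ (Fin p ⊕ (τ × Fin (p * 2)))) → MvPowerSeries (Option σ ⊕ T) K :=
    fun o => o.elim (X (Sum.inl none)) fun j =>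
      substHom inc (Sum.elim (fun i => X (Sum.inl i)) y' j)
  have hψ : ∀ i, constantCoeff (ψ i) = 0 := by
    rintro (_ | j)
    · exact constantCoeff_X _
    · change constantCoeff (substHom inc _) = 0
      rw [constantCoeff_substHom, hXy']
  have hψc : ∀ i, ψ i ∈ convergent v _ := by
    rintro (_ | i | i)
    · exact X_mem_convergent _
    · exact substHom_mem_convergent hinc hincc (X_mem_convergent _)
    · exact substHom_mem_convergent hinc hincc (hy'c i)
  have hψpoly : ∀ {q : ℕ} (R : Fin q → MvPowerSeries (σ ⊕ (Fin p ⊕ (τ × Fin (p * 2)))) K),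
      (∀ j, R j ∈ convergentRelations v bar) → substHom ψ (nonePoly R) = 0 := by
    intro q R hR
    rw [substHom_nonePoly hψ]
    refine Finset.sum_eq_zero fun j _ => ?_
    have h1 : substHom (fun i => ψ (some i)) (R j) =
        substHom inc (substHom (Sum.elim (fun i => X (Sum.inl i)) y') (R j)) := by
      rw [substHom_substHom hXy' hinc]
      rfl
    rw [h1, hrel _ (hR j), map_zero, zero_mul]
  have hψY0 : ∀ k, constantCoeff (substHom ψ (Y₁ k)) = 0 := fun k => by
    rw [constantCoeff_substHom, hY₁0]
  have hψξ : ∀ g, substHom ψ (substHom (Sum.elim ξ Y₁) g) =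
      substHom (Sum.elim (fun i => X (Sum.inl i)) fun k => substHom ψ (Y₁ k)) g := by
    intro g
    rw [substHom_substHom hξY hψ]
    congr 2
    funext j
    rcases j with (_ | i) | k
    · simp only [Sum.elim_inl, ξ, Option.elim_none, substHom_X hψ]
      rfl
    · simp only [Sum.elim_inl, ξ, Option.elim_some, substHom_X hψ]
      change substHom inc (X (Sum.inl i)) = _
      rw [substHom_X hinc]
      rfl
    · rfl
  have hst : ∀ i, constantCoeff (someEmb (t i)) = 0 := fun i => by
    rw [constantCoeff_substHom, ht0]
  have hXst := constantCoeff_sumElim_eq_zero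
    (fun i : Option σ => constantCoeff_X (R := K) i) hst
  have htψ : ∀ g, substHom (Sum.elim X fun i => someEmb (t i)) (substHom ψ g) = substHom B g := by
    intro g
    have h1 : ∀ h, substHom (Sum.elim X fun i => someEmb (t i)) (substHom inc h) =
        someEmb (substHom (Sum.elim X t) h) := by
      intro h
      rw [substHom_substHom hinc hXst, substHom_substHom hXt (fun i => constantCoeff_X _)]
      congr 2
      funext j
      rcases j with j | j
      · simp only [inc, Sum.elim_inl, substHom_X hXst, substHom_X (fun i => constantCoeff_X _)]
      · simp only [inc, Sum.elim_inr, substHom_X hXst]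
    rw [substHom_substHom hψ hXst]
    congr 2
    funext o
    rcases o with _ | i | i
    · simp only [ψ, Option.elim_none, substHom_X hXst]
      rfl
    · simp only [ψ, Option.elim_some, h1, Sum.elim_inl, substHom_X hXt]
      rfl
    · simp only [ψ, Option.elim_some, h1, Sum.elim_inr, hy't]
      rfl
  refine hasConvergentFamily_of_approximation hf hM hδ hJ (A := substHom ψ A₁)
    (e := substHom ψ e₁) (Y := fun k => substHom ψ (Y₁ k)) (G := fun i => substHom ψ (Q i))
    (t := fun i => someEmb (t i)) (substHom_mem_convergent hψ hψc hA₁c)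
    (substHom_mem_convergent hψ hψc he₁c) (fun k => substHom_mem_convergent hψ hψc (hY₁c k))
    (fun i => substHom_mem_convergent hψ hψc (hQc i)) hψY0 hst
    (by rwa [constantCoeff_substHom]) ?_ (fun i => ?_) ?_ ?_ w (fun k => ?_)
  · rw [← constantCoeff_substHom (Sum.elim X fun i => someEmb (t i)), htψ, hBA, hW0]
  · rw [← hψξ, hQR, map_add, hψpoly _ (hR0 i), add_zero, map_mul, map_pow]
  · rw [← hψξ, heS, map_add, hψpoly _ hS0, add_zero, map_mul]
  · rwa [htψ, hBA]
  · rw [htψ, htψ, hBA, hBY, hyc k, add_comm]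

end RegularStep

end MvPowerSeries

/-! ### Changes of base variables and the induction. -/

namespace MvPowerSeries

variable {K : Type*} [Field K] {σ τ : Type}

section Transport

variable [Fintype σ] [Fintype τ] {σ' : Type} [Fintype σ'] {v : AbsoluteValue K ℝ}

/-- The substitution acting on the first group of variables only. -/
noncomputable def sumSubst (τ : Type) (a : σ → MvPowerSeries σ' K) :
    σ ⊕ τ → MvPowerSeries (σ' ⊕ τ) K :=
  Sum.elim (fun i => substHom (fun j => X (Sum.inl j)) (a i)) fun k => X (Sum.inr k)

omit [Fintype σ] [Fintype τ] in
lemma constantCoeff_sumSubst {a : σ → MvPowerSeries σ' K} (ha : ∀ i, constantCoeff (a i) = 0) :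
    ∀ i, constantCoeff (sumSubst τ a i) = 0 :=
  constantCoeff_sumElim_eq_zero (fun i => by rw [constantCoeff_substHom, ha])
    fun k => constantCoeff_X _

omit [Fintype σ] in
lemma sumSubst_mem_convergent {a : σ → MvPowerSeries σ' K} (hac : ∀ i, a i ∈ convergent v σ')
    (i : σ ⊕ τ) : sumSubst τ a i ∈ convergent v (σ' ⊕ τ) := by
  rcases i with i | k
  · exact substHom_mem_convergent (fun j => constantCoeff_X _) (fun j => X_mem_convergent _) (hac i)
  · exact X_mem_convergent _

lemma substHom_sumElim_sumSubst {ρ : Type} {a : σ → MvPowerSeries σ' K}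
    (ha : ∀ i, constantCoeff (a i) = 0) {b : σ' → MvPowerSeries ρ K} {c : τ → MvPowerSeries ρ K}
    (hb : ∀ i, constantCoeff (b i) = 0) (hc : ∀ i, constantCoeff (c i) = 0)
    (f : MvPowerSeries (σ ⊕ τ) K) :
    substHom (Sum.elim b c) (substHom (sumSubst τ a) f) =
      substHom (Sum.elim (fun i => substHom b (a i)) c) f := by
  have hbc := constantCoeff_sumElim_eq_zero hb hc
  rw [substHom_substHom (constantCoeff_sumSubst ha) hbc]
  congr 2
  funext j
  rcases j with i | k
  · simp only [sumSubst, Sum.elim_inl, substHom_rename hbc]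
  · simp only [sumSubst, Sum.elim_inr, substHom_X hbc]

/-- Convergent families transform well under changes of the base variables. -/
theorem HasConvergentFamily.of_substHom {a : σ → MvPowerSeries σ' K} {b : σ' → MvPowerSeries σ K}
    (ha : ∀ i, constantCoeff (a i) = 0) (hb : ∀ i, constantCoeff (b i) = 0)
    (hbc : ∀ i, b i ∈ convergent v σ) (hab : ∀ i, substHom b (a i) = X i)
    {F : Set (MvPowerSeries (σ ⊕ τ) K)} {F' : Set (MvPowerSeries (σ' ⊕ τ) K)}
    (hF : ∀ f ∈ F, substHom (sumSubst τ a) f ∈ F') {ybar : τ → MvPowerSeries σ K}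
    (h : HasConvergentFamily v F' fun k => substHom a (ybar k)) :
    HasConvergentFamily v F ybar := by
  obtain ⟨T, hT, y, t, hyc, hy0, ht0, hyt, hy⟩ := h
  have hβ := constantCoeff_sumSubst (τ := T) hb
  have hbt : ∀ i, constantCoeff (substHom b (t i)) = 0 := fun i => by
    rw [constantCoeff_substHom, ht0]
  refine ⟨T, hT, fun k => substHom (sumSubst T b) (y k), fun i => substHom b (t i),
    fun k => substHom_mem_convergent hβ (sumSubst_mem_convergent hbc) (hyc k),
    fun k => by rw [constantCoeff_substHom, hy0], hbt, fun k => ?_, fun f hf => ?_⟩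
  · rw [substHom_sumElim_sumSubst hb (fun i => constantCoeff_X _) hbt]
    have h1 : substHom b (substHom (Sum.elim X t) (y k)) = ybar k := by
      rw [hyt, substHom_substHom ha hb]
      simp only [hab]
      exact substHom_X_eq _
    rw [← h1, substHom_substHom
      (constantCoeff_sumElim_eq_zero (fun i => constantCoeff_X _) ht0) hb]
    congr 2
    funext j
    rcases j with j | j
    · simp only [Sum.elim_inl, substHom_X_eq, substHom_X hb]
    · rfl
  · have h1 := hy _ (hF f hf)
    have hXy := constantCoeff_sumElim_eq_zero (constantCoeff_X_inl (K := K) (σ := σ') (τ := T)) hy0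
    have ha' : ∀ i, constantCoeff (substHom (fun j : σ' => (X (Sum.inl j) :
        MvPowerSeries (σ' ⊕ T) K)) (a i)) = 0 := fun i => by rw [constantCoeff_substHom, ha]
    rw [substHom_sumElim_sumSubst ha constantCoeff_X_inl hy0] at h1
    have h2 := congrArg (substHom (sumSubst T b)) h1
    rw [map_zero, substHom_substHom (constantCoeff_sumElim_eq_zero ha' hy0) hβ] at h2
    rw [← h2]
    congr 2
    funext j
    rcases j with i | k
    · simp only [Sum.elim_inl, substHom_rename hβ]
      simp only [sumSubst, Sum.elim_inl]
      rw [← substHom_substHom hb constantCoeff_X_inl, hab, substHom_X constantCoeff_X_inl]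
    · rfl

end Transport

section LinearChange

variable [Fintype σ]

/-- On the line with direction `c`, the coefficient of degree `n` is the value at `c` of the
homogeneous part of degree `n`. Regularity thus becomes the nonvanishing of a polynomial at a point.
-/
lemma coeff_substHom_line (c : Option σ → K) (n : ℕ) (F : MvPowerSeries (Option σ) K) :
    coeff (Finsupp.single none n) (substHom (fun i => C (c i) * X none :
      Option σ → MvPowerSeries (Option σ) K) F) =
    MvPolynomial.eval c (open Classical in ∑ d ∈ Finset.univ.finsuppAntidiag n,
      MvPolynomial.monomial d (coeff d F)) := by
  classical
  have ha : ∀ i, constantCoeff (C (c i) * X none : MvPowerSeries (Option σ) K) = 0 :=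
    fun i => by simp
  have hprod : ∀ d : Option σ →₀ ℕ,
      (d.prod fun s k => (C (c s) * X none : MvPowerSeries (Option σ) K) ^ k) =
        monomial (Finsupp.single none (∑ s, d s)) (d.prod fun s k => c s ^ k) := by
    intro d
    rw [Finsupp.prod_fintype _ _ (by simp), Finsupp.prod_fintype _ _ (by simp)]
    simp only [mul_pow, Finset.prod_mul_distrib, Finset.prod_pow_eq_pow_sum, ← map_pow,
      ← map_prod]
    rw [X_pow_eq, ← monomial_zero_eq_C_apply, monomial_mul_monomial, zero_add, mul_one]
  rw [substHom_eq ha, coeff_subst (hasSubst_of_constantCoeff_zero ha),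
    finsum_eq_sum_of_support_subset (s := Finset.univ.finsuppAntidiag n), map_sum]
  · refine Finset.sum_congr rfl fun d hd => ?_
    rw [hprod, (Finset.mem_finsuppAntidiag.1 hd).1, coeff_monomial_same, smul_eq_mul,
      MvPolynomial.eval_monomial]
  · intro d hd
    by_contra h
    refine hd ?_
    have hne : n ≠ ∑ s, d s := fun h1 => h (by simp [h1])
    beta_reduce
    rw [hprod, coeff_monomial_ne, smul_zero]
    exact fun h2 => hne (Finsupp.single_injective _ h2)

/-- After a linear change of variables, a nonzero power series over an infinite field is regular
in the distinguished variable. -/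
theorem exists_linear_regular [Infinite K] (v : AbsoluteValue K ℝ)
    {F : MvPowerSeries (Option σ) K} (hF : F ≠ 0) :
    ∃ a b : Option σ → MvPowerSeries (Option σ) K,
      (∀ i, constantCoeff (a i) = 0) ∧ (∀ i, constantCoeff (b i) = 0) ∧
      (∀ i, a i ∈ convergent v _) ∧ (∀ i, b i ∈ convergent v _) ∧
      (∀ i, substHom b (a i) = X i) ∧
      ∃ p, coeff (Finsupp.single none p) (substHom a F) ≠ 0 := by
  classical
  obtain ⟨d₀, hd₀⟩ : ∃ d, coeff d F ≠ 0 := by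
    by_contra! h
    exact hF (MvPowerSeries.ext h)
  set n := ∑ s, d₀ s with hn
  set P : MvPolynomial (Option σ) K := ∑ d ∈ Finset.univ.finsuppAntidiag n,
    MvPolynomial.monomial d (coeff d F) with hP_def
  have hP : P ≠ 0 := by
    intro h
    have h1 := congrArg (MvPolynomial.coeff d₀) h
    rw [hP_def, MvPolynomial.coeff_sum] at h1
    simp only [MvPolynomial.coeff_monomial, Finset.sum_ite_eq', MvPolynomial.coeff_zero] at h1
    rw [if_pos (by simp [hn])] at h1
    exact hd₀ h1
  -- Including the factor `X none` ensures `c none ≠ 0`, which makes the linear change invertible.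
  obtain ⟨c, hc⟩ : ∃ c, MvPolynomial.eval c (MvPolynomial.X none * P) ≠ 0 := by
    by_contra! h
    exact mul_ne_zero (MvPolynomial.X_ne_zero _) hP (MvPolynomial.funext fun c => by
      rw [h, map_zero])
  rw [map_mul, MvPolynomial.eval_X] at hc
  have hc0 := left_ne_zero_of_mul hc
  set a' : Option σ → MvPowerSeries (Option σ) K := fun i => C (c i) * X none with ha'_def
  set s : Option σ → MvPowerSeries (Option σ) K := fun o => o.elim 0 fun i => X (some i)
  have ha' : ∀ i, constantCoeff (a' i) = 0 := fun i => by simp [a']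
  have hs : ∀ i, constantCoeff (s i) = 0 := by rintro (_ | i) <;> simp [s]
  let b : Option σ → MvPowerSeries (Option σ) K := fun o =>
    o.elim (C (c none)⁻¹ * X none) fun i => X (some i) - C (c (some i) * (c none)⁻¹) * X none
  have hb : ∀ i, constantCoeff (b i) = 0 := by rintro (_ | i) <;> simp [b]
  have hX : ∀ i, X i ∈ convergent v (Option σ) := fun i => X_mem_convergent i
  have hC : ∀ c, C c ∈ convergent v (Option σ) := fun c => C_mem_convergent c
  refine ⟨fun i => a' i + s i, b, constantCoeff_add_eq_zero ha' hs, hb, ?_, ?_,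
    ?_, n, ?_⟩
  · rintro (_ | i)
    · exact add_mem (mul_mem (hC _) (hX _)) (zero_mem _)
    · exact add_mem (mul_mem (hC _) (hX _)) (hX _)
  · rintro (_ | i)
    · exact mul_mem (hC _) (hX _)
    · exact sub_mem (hX _) (mul_mem (hC _) (hX _))
  · have hcc : (C (c none) : MvPowerSeries (Option σ) K) * C (c none)⁻¹ = 1 := by
      rw [← map_mul, mul_inv_cancel₀ hc0, map_one]
    have hbn : b none = C (c none)⁻¹ * X none := rfl
    have hbs : ∀ i, b (some i) = X (some i) - C (c (some i)) * C (c none)⁻¹ * X none := fun i => by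
      rw [← map_mul]
      rfl
    rintro (_ | i)
    · simp only [a', s, Option.elim_none, add_zero, map_mul, substHom_C, substHom_X hb, hbn]
      rw [← mul_assoc, hcc, one_mul]
    · simp only [a', s, Option.elim_some, map_add, map_mul, substHom_C, substHom_X hb, hbn, hbs]
      ring
  · obtain ⟨q, -, hq⟩ := exists_substHom_add_mul_eq v F
    have h1 := congrArg noneSpec (hq a' s ha' hs)
    rw [map_add, map_sum, Finset.sum_eq_zero, add_zero] at h1
    · rw [← coeff_noneSpec, h1, coeff_noneSpec, ha'_def, coeff_substHom_line]
      convert right_ne_zero_of_mul hc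
    · rintro (_ | i) - <;> simp [s]

end LinearChange

section Induction

variable [CharZero K] {v : AbsoluteValue K ℝ}

theorem hasConvergentFamily_option [Fintype σ]
    (IH : ∀ (τ : Type) [Fintype τ] (c : τ → MvPowerSeries σ K),
      (∀ i, constantCoeff (c i) = 0) → HasConvergentFamily v (convergentRelations v c) c)
    [Fintype τ] {ybar : τ → MvPowerSeries (Option σ) K}
    (hybar : ∀ k, constantCoeff (ybar k) = 0) :
    HasConvergentFamily v (convergentRelations v ybar) ybar := by
  refine hasConvergentFamily_relations_of_nondegenerate fun ι _ _ f M δ hf hM hδ hJ hne => ?_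
  obtain ⟨a, b, ha, hb, hac, hbc, hab, p, hp⟩ := exists_linear_regular v hne
  have hα := constantCoeff_sumSubst (τ := τ) ha
  have hαc := sumSubst_mem_convergent (τ := τ) hac
  set α := sumSubst τ a with hα_def
  have haY : ∀ k, constantCoeff (substHom a (ybar k)) = 0 := fun k => by
    rw [constantCoeff_substHom, hybar]
  have hXY := constantCoeff_sumElim_eq_zero (fun i : Option σ => constantCoeff_X (R := K) i) hybar
  have hspec : ∀ g, substHom (Sum.elim X fun k => substHom a (ybar k)) (substHom α g) =
      substHom a (substHom (Sum.elim X ybar) g) := by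
    intro g
    rw [substHom_sumElim_sumSubst ha (fun i => constantCoeff_X _) haY, substHom_substHom hXY ha]
    congr 2
    funext j
    rcases j with j | k
    · simp only [Sum.elim_inl, substHom_X_eq, substHom_X ha]
    · rfl
  have hder : ∀ k g, pderiv K (Sum.inr k) (substHom α g) =
      substHom α (pderiv K (Sum.inr k) g) := by
    classical
    intro k g
    rw [pderiv_substHom hα, Finset.sum_eq_single (Sum.inr k)]
    · simp [hα_def, sumSubst]
    · rintro (i | l) - hl
      · have : pderiv K (Sum.inr k) (α (Sum.inl i)) = 0 := by
          simp only [hα_def, sumSubst, Sum.elim_inl]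
          rw [pderiv_substHom (fun j => constantCoeff_X _)]
          exact Finset.sum_eq_zero fun j _ => by rw [pderiv_X_of_ne (by simp), mul_zero]
        rw [this, mul_zero]
      · simp only [hα_def, sumSubst, Sum.elim_inr]
        rw [pderiv_X_of_ne (fun h => hl h), mul_zero]
    · simp
  refine HasConvergentFamily.of_substHom ha hb hbc hab
    (F' := Set.range fun i => substHom α (f i)) (by rintro _ ⟨i, rfl⟩; exact ⟨i, rfl⟩) ?_
  refine hasConvergentFamily_of_regular IH haY
    -- Multiplying `M` and `δ` by the distinguished variable preserves the matrix identity and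
    -- guarantees that `δ` has no constant term, so a unit `δ` needs no separate treatment. The
    -- exponent of regularity rises from `p` to `p + 1`.
    (M := fun k j => X (Sum.inl none) * substHom α (M k j)) (δ := X (Sum.inl none) * substHom α δ)
    (fun i => ⟨substHom_mem_convergent hα hαc (hf i).1, ?_⟩)
    (fun k j => mul_mem (X_mem_convergent _) (substHom_mem_convergent hα hαc (hM k j)))
    (mul_mem (X_mem_convergent _) (substHom_mem_convergent hα hαc hδ)) (fun i j => ?_)
    ⟨p + 1, ?_⟩ (by simp)
  · rw [hspec, (hf i).2, map_zero]
  · have h1 := congrArg (substHom α) (hJ i j)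
    simp only [hder, mul_left_comm _ (X (Sum.inl none)), ← map_mul]
    rw [← Finset.mul_sum, ← map_sum, h1]
    split_ifs <;> simp
  · rw [map_mul, hspec, substHom_X (constantCoeff_sumElim_eq_zero
      (fun i => constantCoeff_X _) haY), Sum.elim_inl, ← coeff_noneSpec, map_mul, noneSpec_X_none,
      PowerSeries.coeff_succ_X_mul, coeff_noneSpec]
    exact hp

omit [CharZero K] in
lemma eq_zero_of_isEmpty [IsEmpty σ] {f : MvPowerSeries σ K} (hf : constantCoeff f = 0) :
    f = 0 := by
  ext d
  rw [Subsingleton.elim d 0, coeff_zero_eq_constantCoeff_apply, hf, map_zero]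

omit [CharZero K] in
-- Without base variables `ybar` is zero, and a relation says only that the constant term vanishes.
-- The zero family without parameters suffices.
lemma hasConvergentFamily_of_isEmpty [IsEmpty σ] [Fintype σ] [Fintype τ]
    {ybar : τ → MvPowerSeries σ K} (hybar : ∀ k, constantCoeff (ybar k) = 0) :
    HasConvergentFamily v (convergentRelations v ybar) ybar := by
  refine ⟨Empty, inferInstance, fun _ => 0, fun _ => 0, fun _ => zero_mem _, by simp, by simp,
    fun k => ?_, fun f hf => eq_zero_of_isEmpty ?_⟩
  · rw [map_zero, eq_zero_of_isEmpty (hybar k)]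
  · rw [constantCoeff_substHom, ← constantCoeff_substHom (Sum.elim X ybar), hf.2, map_zero]

/-- Every formal power series solution is a specialization of a convergent family satisfying all
its convergent relations. -/
theorem hasConvergentFamily_convergentRelations (v : AbsoluteValue K ℝ) (σ : Type) [Finite σ] :
    ∀ [Fintype σ] (τ : Type) [Fintype τ] (c : τ → MvPowerSeries σ K),
      (∀ i, constantCoeff (c i) = 0) → HasConvergentFamily v (convergentRelations v c) c := by
  classical
  induction σ using Finite.induction_empty_option with
  | of_equiv e ih =>
    intro _ τ _ c hc
    have := Fintype.ofEquiv _ e.symm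
    have hb : ∀ i, constantCoeff ((fun i => X (e i)) i : MvPowerSeries _ K) = 0 :=
      fun i => constantCoeff_X _
    have ha : ∀ i, constantCoeff ((fun i => X (e.symm i)) i : MvPowerSeries _ K) = 0 :=
      fun i => constantCoeff_X _
    refine HasConvergentFamily.of_substHom ha hb (fun i => X_mem_convergent _) (fun i => ?_)
      (fun f hf => ?_) (ih τ (fun k => substHom (fun i => X (e.symm i)) (c k))
        fun k => by rw [constantCoeff_substHom, hc])
    · rw [substHom_X hb, e.apply_symm_apply]
    · have haY : ∀ k, constantCoeff (substHom (fun i => X (e.symm i)) (c k)) = 0 := fun k => by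
        rw [constantCoeff_substHom, hc]
      refine ⟨substHom_mem_convergent (constantCoeff_sumSubst ha)
        (sumSubst_mem_convergent fun i => X_mem_convergent _) hf.1, ?_⟩
      rw [substHom_sumElim_sumSubst ha (fun i => constantCoeff_X _) haY]
      have h1 := congrArg (substHom fun i => X (e.symm i)) hf.2
      rw [map_zero, substHom_substHom
        (constantCoeff_sumElim_eq_zero (fun i => constantCoeff_X _) hc) ha] at h1
      rw [← h1]
      congr 2
      funext j
      rcases j with j | k
      · simp only [Sum.elim_inl, substHom_X_eq, substHom_X ha]
      · rfl
  | h_empty =>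
    intro _ τ _ c hc
    exact hasConvergentFamily_of_isEmpty hc
  | h_option ih =>
    intro _ τ _ c hc
    rename_i α _ inst
    have := hasConvergentFamily_option (v := v) (fun τ _ c hc => ih τ c hc) hc
    convert this

end Induction

end MvPowerSeries

/-! ### The approximation theorem. -/

theorem mainTheorem1 {K : Type*} [Field K] [CharZero K]
    (v : AbsoluteValue K ℝ) (hv : v.IsNontrivial)
    (n m N : ℕ)
    (f : Fin m → MvPowerSeries (Fin n ⊕ Fin N) K)
    (hf : ∀ i, (f i).IsConvergent v)
    (ybar : Fin N → MvPowerSeries (Fin n) K)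
    (hybar0 : ∀ ν, MvPowerSeries.constantCoeff (ybar ν) = 0)
    (hybar : ∀ i, MvPowerSeries.subst
      (Sum.elim (fun j : Fin n => (MvPowerSeries.X j : MvPowerSeries (Fin n) K)) ybar) (f i) = 0) :
    ∃ (s : ℕ) (y : Fin N → MvPowerSeries (Fin n ⊕ Fin s) K)
      (tbar : Fin s → MvPowerSeries (Fin n) K),
      (∀ ν, (y ν).IsConvergent v) ∧
      (∀ ν, MvPowerSeries.constantCoeff (y ν) = 0) ∧
      (∀ σ, MvPowerSeries.constantCoeff (tbar σ) = 0) ∧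
      (∀ i, MvPowerSeries.subst
        (Sum.elim
          (fun j : Fin n => (MvPowerSeries.X (Sum.inl j) : MvPowerSeries (Fin n ⊕ Fin s) K)) y)
        (f i) = 0) ∧
      (∀ ν, ybar ν = MvPowerSeries.subst
        (Sum.elim (fun j : Fin n => (MvPowerSeries.X j : MvPowerSeries (Fin n) K)) tbar)
        (y ν)) := by
  open MvPowerSeries in
  obtain ⟨T, _, y, t, hyc, hy0, ht0, hyt, hy⟩ :=
    hasConvergentFamily_convergentRelations v (Fin n) (Fin N) ybar hybar0
  let e := Fintype.equivFin T
  let r : Fin n ⊕ T → MvPowerSeries (Fin n ⊕ Fin (Fintype.card T)) K := fun j => X (j.map id e)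
  have hr : ∀ i, constantCoeff (r i) = 0 := fun i => constantCoeff_X _
  have hry : ∀ k, constantCoeff (substHom r (y k)) = 0 := fun k => by
    rw [constantCoeff_substHom, hy0]
  have hte : ∀ i, constantCoeff (t (e.symm i)) = 0 := fun i => ht0 _
  have hXy := constantCoeff_sumElim_eq_zero (constantCoeff_X_inl (K := K) (σ := Fin n) (τ := T)) hy0
  refine ⟨Fintype.card T, fun k => substHom r (y k), fun i => t (e.symm i), fun k => ?_, hry, hte,
    fun i => ?_, fun k => ?_⟩
  · exact isConvergent_iff_mem_convergent.2
      (substHom_mem_convergent hr (fun i => X_mem_convergent _) (hyc k))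
  · rw [← substHom_eq (constantCoeff_sumElim_eq_zero constantCoeff_X_inl hry)]
    -- The given equations are among the convergent relations of `ybar`, all of which vanish on the
    -- family.
    have h1 := hy (f i) ⟨isConvergent_iff_mem_convergent.1 (hf i), by
      rw [substHom_eq (constantCoeff_sumElim_eq_zero (fun j => constantCoeff_X _) hybar0)]
      exact hybar i⟩
    have h2 := congrArg (substHom r) h1
    rw [map_zero, substHom_substHom hXy hr] at h2
    rw [← h2]
    congr 2
    funext j
    rcases j with j | k
    · simp only [Sum.elim_inl, substHom_X hr]
      rfl
    · rfl
  · have hXt := constantCoeff_sumElim_eq_zero (fun j : Fin n => constantCoeff_X (R := K) j) hte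
    rw [← substHom_eq hXt, substHom_rename hXt, ← hyt]
    congr 2
    funext j
    rcases j with j | j
    · rfl
    · simp
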